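/- **Definitions.** An N-function is a function $A(t)=\int_0^t a(\tau)\,d\tau$, $t\ge 0$, where $a:[0,\infty)\to\mathbb{R}$ is right-continuous, non-decreasing, positive on $(0,\infty)$, with $a(0)=0$ and $\lim_{t\to\infty}a(t)=\infty$. Its complementary function is $\widetilde A(t)=\sup\{tw-A(w):w>0\}$. For N-functions $H,R$ we write $H\ll R$ at infinity if $\lim_{t\to\infty}H(\lambda t)/R(t)=0$ for every $\lambda>0$. For a measure $\mu$, $L^A_\mu$ is the set of measurable $u$ with $\int A(|u|)\,d\mu<\infty$, and $\|u\|_{L^A_\mu}=\inf\{\lambda>0:\int A(|u|/\lambda)\,d\mu\le 1\}$; the measure is omitted when it is Lebesgue measure. Let $B$ be the open unit ball of $\mathbb{R}^n$, $n\ge 1$. For an N-function $G$, $W^{1,G}(B)$ is the set of $u\in L^G(B)$ with a weak gradient such that $\int_B G(|\nabla u|)\,dx<\infty$, with $\|u\|_{W^{1,G}(B)}=\|u\|_{L^G(B)}+\|\nabla u\|_{L^G(B)}$; $W^{1,G}_0(B)$ is the closure of $C_c^\infty(B)$ in $W^{1,G}(B)$ for this norm, and $X_{rad}(B)$ is the set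 of radial functions in $W^{1,G}_0(B)$, with the same norm. **Proposition.** Let $G$ and $R$ be N-functions and let $\alpha>0$. Suppose that $$\int_0^1 r^{\alpha+n-1}\,R\Big(\|s^{1-n}\|_{L^{\widetilde G}((r,1),\,s^{n-1}ds)}\Big)\,dr<\infty .$$ Let $d\mu=|x|^\alpha\,dx$ on $B$. Then: (i) $X_{rad}(B)\subset L^R_\mu(B)$ and the inclusion is continuous: there is a constant $C$ with $\|u\|_{L^R_\mu(B)}\le C\|u\|_{W^{1,G}(B)}$ for all $u\in X_{rad}(B)$; (ii) for every N-function $H$ with $H\ll R$ at infinity, $X_{rad}(B)\subset L^H_\mu(B)$ and the inclusion is continuous and compact: every sequence in $X_{rad}(B)$ that is bounded in $W^{1,G}(B)$ has a subsequence converging in the norm of $L^H_\mu(B)$ to an element of $L^H_\mu(B)$. -/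

import Mathlib

open MeasureTheory Filter Topology Set
open scoped ENNReal NNReal ContDiff

noncomputable section

/-- `A` is an N-function: `A t = ∫₀ᵗ a` for `t ≥ 0`, where `a` is right-continuous on `[0, ∞)`,
positive on `(0, ∞)`, non-decreasing, `a 0 = 0` and `a t → ∞` as `t → ∞`.
Only the values of `A` on `[0, ∞)` are ever used. -/
def IsNFunction (A : ℝ → ℝ) : Prop :=
  ∃ a : ℝ → ℝ,
    (∀ t, 0 ≤ t → ContinuousWithinAt a (Ici t) t) ∧
    (∀ t, 0 < t → 0 < a t) ∧
    MonotoneOn a (Ici 0) ∧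
    a 0 = 0 ∧
    Tendsto a atTop atTop ∧
    ∀ t, 0 ≤ t → A t = ∫ τ in (0 : ℝ)..t, a τ

/-- The complementary function `t ↦ sup {t w - A w : w > 0}`. For an N-function `A` and `t ≥ 0`
the supremum is over a non-empty set that is bounded above. -/
def complementary (A : ℝ → ℝ) (t : ℝ) : ℝ :=
  sSup ((fun w : ℝ => t * w - A w) '' Ioi 0)

/-- `A ≪ D` at infinity: `A (l t) / D t → 0` as `t → ∞`, for every `l > 0`. -/
def EssentiallySlower (A D : ℝ → ℝ) : Prop :=
  ∀ l : ℝ, 0 < l → Tendsto (fun t : ℝ => A (l * t) / D t) atTop (𝓝 0)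

section Orlicz

variable {X F : Type*} [MeasurableSpace X] [NormedAddCommGroup F]

/-- The modular `∫ A(|u|) dμ`. -/
def modular (A : ℝ → ℝ) (μ : Measure X) (u : X → F) : ℝ≥0∞ :=
  ∫⁻ x, ENNReal.ofReal (A ‖u x‖) ∂μ

/-- Membership in the Orlicz space `L^A_μ`: `u` is measurable and `∫ A(|u|) dμ < ∞`. -/
def MemOrlicz (A : ℝ → ℝ) (μ : Measure X) (u : X → F) : Prop :=
  AEStronglyMeasurable u μ ∧ modular A μ u < ⊤

/-- The Luxemburg norm `inf {l > 0 : ∫ A(|u| / l) dμ ≤ 1}` (equal to `∞` if there is no such `l`). -/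
def luxNorm (A : ℝ → ℝ) (μ : Measure X) (u : X → F) : ℝ≥0∞ :=
  ⨅ (l : ℝ) (_ : 0 < l) (_ : ∫⁻ x, ENNReal.ofReal (A (‖u x‖ / l)) ∂μ ≤ 1), ENNReal.ofReal l

end Orlicz

section Sobolev

variable {n : ℕ}

/-- `φ ∈ C_c^∞(Ω)`. -/
def IsTestFunction (Ω : Set (EuclideanSpace ℝ (Fin n))) (φ : EuclideanSpace ℝ (Fin n) → ℝ) :
    Prop :=
  ContDiff ℝ ∞ φ ∧ HasCompactSupport φ ∧ tsupport φ ⊆ Ω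

/-- `w` is a weak (distributional) gradient of `u` in the open set `Ω`. -/
def HasWeakGradient (Ω : Set (EuclideanSpace ℝ (Fin n))) (u : EuclideanSpace ℝ (Fin n) → ℝ)
    (w : EuclideanSpace ℝ (Fin n) → EuclideanSpace ℝ (Fin n)) : Prop :=
  LocallyIntegrableOn u Ω ∧ LocallyIntegrableOn w Ω ∧
    ∀ φ : EuclideanSpace ℝ (Fin n) → ℝ, IsTestFunction Ω φ →
      ∫ x in Ω, u x • gradient φ x = - ∫ x in Ω, φ x • w x

open Classical in
/-- The weak gradient of `u` in `Ω` (unique up to null sets when it exists, `0` otherwise). -/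
def weakGradient (Ω : Set (EuclideanSpace ℝ (Fin n))) (u : EuclideanSpace ℝ (Fin n) → ℝ) :
    EuclideanSpace ℝ (Fin n) → EuclideanSpace ℝ (Fin n) :=
  if h : ∃ w, HasWeakGradient Ω u w then h.choose else 0

/-- Membership in the Orlicz-Sobolev space `W^{1,G}(Ω)`. -/
def MemW1 (G : ℝ → ℝ) (Ω : Set (EuclideanSpace ℝ (Fin n)))
    (u : EuclideanSpace ℝ (Fin n) → ℝ) : Prop :=
  MemOrlicz G (volume.restrict Ω) u ∧ (∃ w, HasWeakGradient Ω u w) ∧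
    MemOrlicz G (volume.restrict Ω) (weakGradient Ω u)

/-- The norm `‖u‖_{L^G(Ω)} + ‖∇u‖_{L^G(Ω)}` of `W^{1,G}(Ω)`. -/
def sobolevNorm (G : ℝ → ℝ) (Ω : Set (EuclideanSpace ℝ (Fin n)))
    (u : EuclideanSpace ℝ (Fin n) → ℝ) : ℝ≥0∞ :=
  luxNorm G (volume.restrict Ω) u + luxNorm G (volume.restrict Ω) (weakGradient Ω u)

/-- Membership in `W_0^{1,G}(Ω)`, the closure of `C_c^∞(Ω)` in `W^{1,G}(Ω)`. -/
def MemW10 (G : ℝ → ℝ) (Ω : Set (EuclideanSpace ℝ (Fin n)))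
    (u : EuclideanSpace ℝ (Fin n) → ℝ) : Prop :=
  MemW1 G Ω u ∧ ∀ ε : ℝ≥0∞, 0 < ε → ∃ v : EuclideanSpace ℝ (Fin n) → ℝ, IsTestFunction Ω v ∧
    luxNorm G (volume.restrict Ω) (fun x => u x - v x) +
      luxNorm G (volume.restrict Ω) (fun x => weakGradient Ω u x - gradient v x) < ε

/-- The open unit ball `B` of `ℝⁿ`. -/
def unitBall (n : ℕ) : Set (EuclideanSpace ℝ (Fin n)) := Metric.ball 0 1

/-- `X_rad(B)`: the (a.e.) radial functions in `W_0^{1,G}(B)`. -/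
def Xrad (n : ℕ) (G : ℝ → ℝ) : Set (EuclideanSpace ℝ (Fin n) → ℝ) :=
  {u | MemW10 G (unitBall n) u ∧
    ∃ f : ℝ → ℝ, u =ᵐ[volume.restrict (unitBall n)] fun x => f ‖x‖}

/-- The measure `|x|^α dx` on the unit ball `B`. -/
def henonMeasure (n : ℕ) (α : ℝ) : Measure (EuclideanSpace ℝ (Fin n)) :=
  (volume.restrict (unitBall n)).withDensity fun x => ENNReal.ofReal (‖x‖ ^ α)

/-- `‖s^{1-n}‖` in `L^{G̃}((r,1), s^{n-1} ds)`, where `G̃` is complementary to `G`.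
For an N-function `G` and `0 < r < 1` the Luxemburg norm is finite. -/
def radialProfile (n : ℕ) (G : ℝ → ℝ) (r : ℝ) : ℝ :=
  (luxNorm (complementary G)
    ((volume.restrict (Ioo r 1)).withDensity fun s : ℝ => ENNReal.ofReal (s ^ ((n : ℝ) - 1)))
    (fun s : ℝ => s ^ (1 - (n : ℝ)))).toReal

/-- The condition `∫₀¹ r^{α+n-1} R(‖s^{1-n}‖_{L^{G̃}((r,1), s^{n-1} ds)}) dr < ∞`. -/
def IntegrabilityCondition (n : ℕ) (α : ℝ) (G R : ℝ → ℝ) : Prop :=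
  ∫⁻ r in Ioo (0 : ℝ) 1, ENNReal.ofReal (r ^ (α + (n : ℝ) - 1) * R (radialProfile n G r)) < ⊤

/-- The inclusion `X_rad(B) ⊂ L^A_μ` holds and is continuous, i.e. bounded for the norms. -/
def ContinuousInclusion (n : ℕ) (G A : ℝ → ℝ) (μ : Measure (EuclideanSpace ℝ (Fin n))) : Prop :=
  (∀ u ∈ Xrad n G, MemOrlicz A μ u) ∧
    ∃ C : ℝ≥0, ∀ u ∈ Xrad n G, luxNorm A μ u ≤ C * sobolevNorm G (unitBall n) u

/-- The inclusion `X_rad(B) ⊂ L^A_μ` is continuous and compact: every sequence that is bounded in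
`X_rad(B)` has a subsequence that converges in the norm of `L^A_μ` to an element of `L^A_μ`. -/
def CompactInclusion (n : ℕ) (G A : ℝ → ℝ) (μ : Measure (EuclideanSpace ℝ (Fin n))) : Prop :=
  ContinuousInclusion n G A μ ∧
    ∀ u : ℕ → EuclideanSpace ℝ (Fin n) → ℝ, (∀ k, u k ∈ Xrad n G) →
      (∃ M : ℝ≥0, ∀ k, sobolevNorm G (unitBall n) (u k) ≤ M) →
      ∃ v : EuclideanSpace ℝ (Fin n) → ℝ, MemOrlicz A μ v ∧
        ∃ σ : ℕ → ℕ, StrictMono σ ∧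
          Tendsto (fun k => luxNorm A μ (fun x => u (σ k) x - v x)) atTop (𝓝 0)

end Sobolev

end

/-!
A radial function `u = f(|x|)` in the closure of the test functions is handled through its
approximating test functions `v_j`, without differentiating `f`. In polar coordinates `v_j → f(r)`
in mean over almost every sphere of radius `r`
(`exists_testFunction_tendsto_sphere`). Along a ray, the difference of a test function between the
radii `r < s` is at most `∫ |∇v_j| t^{1-n} t^{n-1} dt`; averaging over directions and applying
Young's inequality to `|∇v_j| / l` and `T t^{1-n}` bounds the mean oscillation by the `L^G` norm of
the gradient and the modular of `T t^{1-n}` for the complementary function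
(`lintegral_sphere_enorm_sub_le`). Three consequences give the result.

* With `s = 1` and `T` the reciprocal of a number above the radial profile
  `p(r) = ‖t^{1-n}‖_{L^{G̃}((r,1))}`, one gets `|u(x)| ≤ C ‖∇u‖ p(|x|)`, and more generally
  `|u| ≤ sup |ψ| + C ‖∇u - ∇ψ‖ p(|x|)` for every test function `ψ`
  (`ae_abs_le_add_radialProfile`). As `R(p(|x|))` is integrable for `|x|^α dx`, the first bound
  controls the Luxemburg norm. Membership in the Orlicz class, the finiteness of `∫ R(|u|)` with no
  scaling and no doubling condition, follows from the second one with `‖∇u - ∇ψ‖` small.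
* If `H ≪ R` at infinity then `H(k p(|x|))` is integrable for every `k > 0`, so that every sequence
  bounded in the Sobolev norm has a majorant suitable for dominated convergence
  (`lintegral_mul_radialProfile_lt_top`).
* For `r < s` away from the origin, a large `T` and then a small `s - r` make the oscillation bound
  small uniformly in the sequence (`exists_modulus_of_oscillation_le`). A diagonal subsequence on a
  countable dense set of radii then converges at almost every radius
  (`exists_subseq_tendsto_ae`), and dominated convergence gives convergence in the norm of `L^H`.
-/

/-! ### N-functions and complementary functions -/

namespace IsNFunction

variable {A : ℝ → ℝ}

lemma map_zero (hA : IsNFunction A) : A 0 = 0 := by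
  obtain ⟨a, -, -, -, -, -, h⟩ := hA
  simpa using h 0 le_rfl

/-- The increments of an N-function lie between the increments of its tangent lines. -/
lemma exists_increment_bounds (hA : IsNFunction A) : ∃ a : ℝ → ℝ, (∀ t, 0 ≤ t → 0 ≤ a t) ∧
    (∀ t, 0 < t → 0 < a t) ∧ MonotoneOn a (Ici 0) ∧ Tendsto a atTop atTop ∧
    ∀ x y, 0 ≤ x → x ≤ y → a x * (y - x) ≤ A y - A x ∧ A y - A x ≤ a y * (y - x) := by
  obtain ⟨a, -, hpos, hmono, h0, hlim, h⟩ := hA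
  have hint : ∀ x y, 0 ≤ x → x ≤ y → IntervalIntegrable a volume x y := fun x y hx hxy =>
    (hmono.mono (by rw [uIcc_of_le hxy]; exact fun z hz => hx.trans hz.1)).intervalIntegrable
  refine ⟨a, fun t ht => ?_, hpos, hmono, hlim, fun x y hx hxy => ?_⟩
  · rcases ht.eq_or_lt with rfl | ht
    · exact h0.ge
    · exact (hpos t ht).le
  have hy := hx.trans hxy
  have hdiff : A y - A x = ∫ τ in x..y, a τ := by
    rw [h y hy, h x hx, intervalIntegral.integral_interval_sub_left (hint 0 y le_rfl hy)
      (hint 0 x le_rfl hx)]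
  rw [hdiff]
  constructor
  · calc a x * (y - x) = ∫ _ in x..y, a x := by simp [mul_comm]
      _ ≤ _ := intervalIntegral.integral_mono_on hxy (by simp) (hint x y hx hxy)
        fun z hz => hmono hx (hx.trans hz.1) hz.1
  · calc _ ≤ ∫ _ in x..y, a y := intervalIntegral.integral_mono_on hxy (hint x y hx hxy) (by simp)
          fun z hz => hmono (hx.trans hz.1) hy hz.2
      _ = a y * (y - x) := by simp [mul_comm]

lemma monotoneOn (hA : IsNFunction A) : MonotoneOn A (Ici 0) := by
  obtain ⟨a, h0, -, -, -, h⟩ := hA.exists_increment_bounds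
  intro x hx y hy hxy
  have := (h x y hx hxy).1
  nlinarith [mul_nonneg (h0 x hx) (sub_nonneg.2 hxy)]

lemma nonneg (hA : IsNFunction A) {t : ℝ} (ht : 0 ≤ t) : 0 ≤ A t :=
  hA.map_zero ▸ hA.monotoneOn (mem_Ici.2 le_rfl) ht ht

lemma pos (hA : IsNFunction A) {t : ℝ} (ht : 0 < t) : 0 < A t := by
  obtain ⟨a, -, hpos, -, -, h⟩ := hA.exists_increment_bounds
  have := (h (t / 2) t (by positivity) (by linarith)).1
  nlinarith [hA.nonneg (half_pos ht).le, mul_pos (hpos _ (half_pos ht)) (half_pos ht)]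

lemma convexOn (hA : IsNFunction A) : ConvexOn ℝ (Ici 0) A := by
  obtain ⟨a, -, -, -, -, h⟩ := hA.exists_increment_bounds
  refine convexOn_of_slope_mono_adjacent (convex_Ici 0) fun {x y z} hx _ hxy hyz => ?_
  have hx' : 0 ≤ x := hx
  calc (A y - A x) / (y - x) ≤ a y := by
        rw [div_le_iff₀ (sub_pos.2 hxy)]; exact (h x y hx' hxy.le).2
    _ ≤ _ := by
        rw [le_div_iff₀ (sub_pos.2 hyz)]; exact (h y z (hx'.trans hxy.le) hyz.le).1

lemma le_mul (hA : IsNFunction A) {c t : ℝ} (hc : 0 ≤ c) (hc1 : c ≤ 1) (ht : 0 ≤ t) :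
    A (c * t) ≤ c * A t := by
  have := hA.convexOn.2 (mem_Ici.2 ht) (mem_Ici.2 le_rfl) hc (sub_nonneg.2 hc1) (by ring)
  simpa [hA.map_zero] using this

lemma bddAbove (hA : IsNFunction A) (t : ℝ) :
    BddAbove ((fun w : ℝ => t * w - A w) '' Ioi 0) := by
  obtain ⟨a, h0, -, -, hlim, h⟩ := hA.exists_increment_bounds
  obtain ⟨w₀, hw₀, hw₀0⟩ := ((hlim.eventually_ge_atTop t).and (eventually_ge_atTop 0)).exists
  refine ⟨|t| * w₀, ?_⟩
  rintro _ ⟨w, hw, rfl⟩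
  have hw' : 0 < w := hw
  have hAw := hA.nonneg hw'.le
  show t * w - A w ≤ |t| * w₀
  rcases le_total w w₀ with hle | hle
  · nlinarith [le_abs_self t, abs_nonneg t, mul_le_mul_of_nonneg_left hle (abs_nonneg t),
      mul_le_mul_of_nonneg_right (le_abs_self t) hw'.le]
  · have := (h w₀ w hw₀0 hle).1
    nlinarith [hA.nonneg hw₀0, mul_le_mul_of_nonneg_right hw₀ (sub_nonneg.2 hle),
      mul_le_mul_of_nonneg_right (le_abs_self t) hw₀0]

/-- Young's inequality. -/
lemma mul_le_add_complementary (hA : IsNFunction A) (t : ℝ) {w : ℝ} (hw : 0 ≤ w) :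
    ENNReal.ofReal (t * w) ≤ ENNReal.ofReal (A w) + ENNReal.ofReal (complementary A t) := by
  rcases hw.eq_or_lt with rfl | hw
  · simp
  have : t * w - A w ≤ complementary A t := le_csSup (hA.bddAbove t) ⟨w, hw, rfl⟩
  exact (ENNReal.ofReal_le_ofReal (by linarith)).trans ENNReal.ofReal_add_le

lemma complementary_mono (hA : IsNFunction A) : Monotone (complementary A) := by
  intro s t hst
  refine csSup_le ⟨_, 1, mem_Ioi.2 one_pos, rfl⟩ ?_
  rintro _ ⟨w, hw, rfl⟩
  refine le_trans ?_ (le_csSup (hA.bddAbove t) ⟨w, hw, rfl⟩)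
  have : s * w ≤ t * w := mul_le_mul_of_nonneg_right hst (le_of_lt hw)
  simpa using this

lemma complementary_le_mul (hA : IsNFunction A) {c : ℝ} (hc : 0 ≤ c) (hc1 : c ≤ 1) (t : ℝ) :
    complementary A (c * t) ≤ c * complementary A t := by
  refine csSup_le ⟨_, 1, mem_Ioi.2 one_pos, rfl⟩ ?_
  rintro _ ⟨w, hw, rfl⟩
  have h1 : t * w - A w ≤ complementary A t := le_csSup (hA.bddAbove t) ⟨w, hw, rfl⟩
  have h2 := hA.nonneg (le_of_lt hw)
  show c * t * w - A w ≤ _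
  nlinarith [mul_le_mul_of_nonneg_left h1 hc, mul_le_mul_of_nonneg_right hc1 h2]

section Measurability

variable {X : Type*} [MeasurableSpace X] {μ : Measure X} {g : X → ℝ}

/-- Only the values of `A` on `[0, ∞)` are constrained, whence the detour through `max · 0`. -/
lemma measurable_max (hA : IsNFunction A) : Measurable fun t => A (max t 0) :=
  Monotone.measurable fun _ _ h =>
    hA.monotoneOn (mem_Ici.2 (le_max_right _ _)) (mem_Ici.2 (le_max_right _ _))
      (max_le_max_right 0 h)

lemma measurable_comp (hA : IsNFunction A) (hg : Measurable g) (h0 : ∀ x, 0 ≤ g x) :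
    Measurable fun x => A (g x) := by
  have := hA.measurable_max.comp hg
  simpa [Function.comp_def, h0] using this

lemma aemeasurable_comp (hA : IsNFunction A) (hg : AEMeasurable g μ) (h0 : ∀ x, 0 ≤ g x) :
    AEMeasurable (fun x => A (g x)) μ := by
  have := hA.measurable_max.comp_aemeasurable hg
  simpa [Function.comp_def, h0] using this

end Measurability

/-- N-functions are continuous at `0`. -/
lemma tendsto_zero (hA : IsNFunction A) {ι : Type*} {f : Filter ι} {g : ι → ℝ}
    (h0 : ∀ i, 0 ≤ g i) (hg : Tendsto g f (𝓝 0)) : Tendsto (fun i => A (g i)) f (𝓝 0) := by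
  have hub : Tendsto (fun i => g i * A 1) f (𝓝 0) := by simpa using hg.mul_const (A 1)
  refine tendsto_of_tendsto_of_tendsto_of_le_of_le' tendsto_const_nhds hub
    (Eventually.of_forall fun i => hA.nonneg (h0 i)) ?_
  filter_upwards [hg.eventually_lt_const one_pos] with i hi
  simpa using hA.le_mul (h0 i) hi.le zero_le_one

end IsNFunction

/-! ### The Luxemburg norm -/

section Luxemburg

variable {X F : Type*} [MeasurableSpace X] [NormedAddCommGroup F] {A : ℝ → ℝ} {μ : Measure X}
  {u v : X → F}

lemma luxNorm_le {l : ℝ} (hl : 0 < l)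
    (h : ∫⁻ x, ENNReal.ofReal (A (‖u x‖ / l)) ∂μ ≤ 1) : luxNorm A μ u ≤ ENNReal.ofReal l :=
  iInf_le_of_le l (iInf_le_of_le hl (iInf_le_of_le h le_rfl))

lemma exists_of_luxNorm_lt {l : ℝ≥0∞} (h : luxNorm A μ u < l) : ∃ k : ℝ, 0 < k ∧
    ENNReal.ofReal k < l ∧ ∫⁻ x, ENNReal.ofReal (A (‖u x‖ / k)) ∂μ ≤ 1 := by
  simp only [luxNorm, iInf_lt_iff] at h
  obtain ⟨k, hk, h1, h2⟩ := h
  exact ⟨k, hk, h2, h1⟩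

lemma lintegral_le_one_of_luxNorm_lt (hA : MonotoneOn A (Ici 0)) {l : ℝ}
    (h : luxNorm A μ u < ENNReal.ofReal l) :
    0 < l ∧ ∫⁻ x, ENNReal.ofReal (A (‖u x‖ / l)) ∂μ ≤ 1 := by
  obtain ⟨k, hk, hkl, h1⟩ := exists_of_luxNorm_lt h
  have hkl' : k < l := (ENNReal.ofReal_lt_ofReal_iff_of_nonneg hk.le).1 hkl
  refine ⟨hk.trans hkl', (lintegral_mono fun x => ENNReal.ofReal_le_ofReal ?_).trans h1⟩
  have hl := hk.trans hkl'
  exact hA (mem_Ici.2 (by positivity)) (mem_Ici.2 (by positivity)) (by gcongr)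

/-- The triangle inequality, from the convexity of `A`. -/
lemma luxNorm_add_le (hA : IsNFunction A) (hu : AEStronglyMeasurable u μ) :
    luxNorm A μ (u + v) ≤ luxNorm A μ u + luxNorm A μ v := by
  refine ENNReal.le_of_forall_pos_le_add fun ε hε htop => ?_
  have hfin := ENNReal.add_lt_top.1 htop
  have hε2 : (ε / 2 : ℝ≥0∞) ≠ 0 := by simpa using hε.ne'
  obtain ⟨a, ha, hal, hau⟩ := exists_of_luxNorm_lt (ENNReal.lt_add_right hfin.1.ne hε2)
  obtain ⟨b, hb, hbl, hbv⟩ := exists_of_luxNorm_lt (ENNReal.lt_add_right hfin.2.ne hε2)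
  have hab := add_pos ha hb
  have key : luxNorm A μ (u + v) ≤ ENNReal.ofReal (a + b) := by
    refine luxNorm_le hab ?_
    calc ∫⁻ x, ENNReal.ofReal (A (‖(u + v) x‖ / (a + b))) ∂μ
        ≤ ∫⁻ x, (ENNReal.ofReal (a / (a + b)) * ENNReal.ofReal (A (‖u x‖ / a)) +
            ENNReal.ofReal (b / (a + b)) * ENNReal.ofReal (A (‖v x‖ / b))) ∂μ := by
          refine lintegral_mono fun x => ?_
          rw [← ENNReal.ofReal_mul (by positivity), ← ENNReal.ofReal_mul (by positivity),
            ← ENNReal.ofReal_add (mul_nonneg (by positivity) (hA.nonneg (by positivity)))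
              (mul_nonneg (by positivity) (hA.nonneg (by positivity)))]
          refine ENNReal.ofReal_le_ofReal ?_
          have hconv := hA.convexOn.2 (mem_Ici.2 (show 0 ≤ ‖u x‖ / a by positivity))
            (mem_Ici.2 (show 0 ≤ ‖v x‖ / b by positivity)) (show 0 ≤ a / (a + b) by positivity)
            (show 0 ≤ b / (a + b) by positivity) (by field_simp)
          refine le_trans (hA.monotoneOn (mem_Ici.2 (by positivity)) (mem_Ici.2 ?_) ?_) hconv
          · simp only [smul_eq_mul]; positivity
          · have : a / (a + b) * (‖u x‖ / a) + b / (a + b) * (‖v x‖ / b)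
                = (‖u x‖ + ‖v x‖) / (a + b) := by field_simp
            simp only [smul_eq_mul, this, Pi.add_apply]
            gcongr
            exact norm_add_le _ _
      _ = ENNReal.ofReal (a / (a + b)) * ∫⁻ x, ENNReal.ofReal (A (‖u x‖ / a)) ∂μ +
            ENNReal.ofReal (b / (a + b)) * ∫⁻ x, ENNReal.ofReal (A (‖v x‖ / b)) ∂μ := by
          have hm : AEMeasurable (fun x => ENNReal.ofReal (A (‖u x‖ / a))) μ :=
            (hA.aemeasurable_comp (hu.norm.aemeasurable.div_const a)
              fun x => by positivity).ennreal_ofReal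
          rw [lintegral_add_left' (hm.const_mul _), lintegral_const_mul'' _ hm,
            lintegral_const_mul' _ _ ENNReal.ofReal_ne_top]
      _ ≤ ENNReal.ofReal (a / (a + b)) * 1 + ENNReal.ofReal (b / (a + b)) * 1 := by gcongr
      _ = 1 := by
          rw [mul_one, mul_one, ← ENNReal.ofReal_add (by positivity) (by positivity), ← add_div,
            div_self hab.ne', ENNReal.ofReal_one]
  calc luxNorm A μ (u + v) ≤ ENNReal.ofReal a + ENNReal.ofReal b :=
        key.trans ENNReal.ofReal_add_le
    _ ≤ (luxNorm A μ u + ε / 2) + (luxNorm A μ v + ε / 2) := by gcongr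
    _ = luxNorm A μ u + luxNorm A μ v + ε := by
        rw [add_add_add_comm, ENNReal.add_halves]

lemma luxNorm_sub_comm (u v : X → F) :
    luxNorm A μ (fun x => u x - v x) = luxNorm A μ (fun x => v x - u x) := by
  simp only [luxNorm, norm_sub_rev]

/-- If `A` is an N-function or the complementary function of one, finiteness of the modular makes
the Luxemburg norm finite. -/
lemma luxNorm_lt_top (hA : ∀ c t : ℝ, 0 ≤ c → c ≤ 1 → 0 ≤ t → A (c * t) ≤ c * A t)
    (h : modular A μ u < ⊤) : luxNorm A μ u < ⊤ := by
  set N : ℝ := max 1 (modular A μ u).toReal with hN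
  have hN1 : 1 ≤ N := le_max_left _ _
  have hN0 : 0 < N := by positivity
  refine (luxNorm_le hN0 ?_).trans_lt ENNReal.ofReal_lt_top
  calc ∫⁻ x, ENNReal.ofReal (A (‖u x‖ / N)) ∂μ
      ≤ ∫⁻ x, ENNReal.ofReal N⁻¹ * ENNReal.ofReal (A ‖u x‖) ∂μ := by
        refine lintegral_mono fun x => ?_
        rw [← ENNReal.ofReal_mul (by positivity), div_eq_inv_mul]
        exact ENNReal.ofReal_le_ofReal
          (hA _ _ (by positivity) (inv_le_one_of_one_le₀ hN1) (norm_nonneg _))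
    _ = ENNReal.ofReal N⁻¹ * modular A μ u := lintegral_const_mul' _ _ ENNReal.ofReal_ne_top
    _ ≤ ENNReal.ofReal N⁻¹ * ENNReal.ofReal N := by
        gcongr
        exact (ENNReal.ofReal_toReal h.ne).symm.le.trans
          (ENNReal.ofReal_le_ofReal (le_max_right _ _))
    _ = 1 := by rw [← ENNReal.ofReal_mul (by positivity), inv_mul_cancel₀ hN0.ne',
        ENNReal.ofReal_one]

lemma luxNorm_mono_measure {ν : Measure X} (h : μ ≤ ν) : luxNorm A μ u ≤ luxNorm A ν u := by
  refine le_of_forall_gt fun l hl => ?_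
  obtain ⟨k, hk, hkl, h1⟩ := exists_of_luxNorm_lt hl
  exact (luxNorm_le hk ((lintegral_mono' h le_rfl).trans h1)).trans_lt hkl

/-- On a finite measure space `L^A` embeds in `L¹`. -/
lemma lintegral_enorm_le_of_luxNorm_lt (hA : IsNFunction A) {l : ℝ}
    (h : luxNorm A μ u < ENNReal.ofReal l) :
    ∫⁻ x, ‖u x‖ₑ ∂μ ≤
      ENNReal.ofReal l * (1 + ENNReal.ofReal (complementary A 1) * μ univ) := by
  obtain ⟨hl, h1⟩ := lintegral_le_one_of_luxNorm_lt hA.monotoneOn h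
  calc ∫⁻ x, ‖u x‖ₑ ∂μ
      ≤ ∫⁻ x, ENNReal.ofReal l * (ENNReal.ofReal (A (‖u x‖ / l)) +
          ENNReal.ofReal (complementary A 1)) ∂μ := by
        refine lintegral_mono fun x => ?_
        refine le_trans (le_of_eq ?_) (mul_le_mul_right (hA.mul_le_add_complementary 1
          (show 0 ≤ ‖u x‖ / l by positivity)) _)
        rw [← ENNReal.ofReal_mul hl.le, one_mul, mul_div_cancel₀ _ hl.ne', ofReal_norm]
    _ ≤ _ := by
        rw [lintegral_const_mul' _ _ ENNReal.ofReal_ne_top, lintegral_add_right _ measurable_const,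
          lintegral_const]
        gcongr

end Luxemburg

/-! ### Polar coordinates in the unit ball -/

section Polar

variable {n : ℕ}

/-- The surface measure of the unit sphere of `ℝⁿ`. -/
noncomputable abbrev sphereMeasure (n : ℕ) :
    Measure (Metric.sphere (0 : EuclideanSpace ℝ (Fin n)) 1) :=
  (volume : Measure (EuclideanSpace ℝ (Fin n))).toSphere

/-- The measure `r^{n-1} dr` on the line, with the density written as in `radialProfile`. -/
noncomputable def radialMeasure (n : ℕ) : Measure ℝ :=
  volume.withDensity fun r : ℝ => ENNReal.ofReal (r ^ ((n : ℝ) - 1))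

lemma sphereMeasure_univ_ne_zero (hn : 1 ≤ n) : sphereMeasure n univ ≠ 0 := by
  have : Nonempty (Fin n) := ⟨⟨0, hn⟩⟩
  exact Measure.measure_univ_ne_zero.2 (Measure.toSphere_ne_zero _)

lemma measurable_rpow_density (n : ℕ) :
    Measurable fun r : ℝ => ENNReal.ofReal (r ^ ((n : ℝ) - 1)) := by fun_prop

lemma measurable_polar (n : ℕ) :
    Measurable fun p : ℝ × Metric.sphere (0 : EuclideanSpace ℝ (Fin n)) 1 =>
      p.1 • (p.2 : EuclideanSpace ℝ (Fin n)) := by fun_prop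

lemma measurable_lintegral_sphere {h : EuclideanSpace ℝ (Fin n) → ℝ≥0∞} (hh : Measurable h) :
    Measurable fun r : ℝ =>
      ∫⁻ θ, h (r • (θ : EuclideanSpace ℝ (Fin n))) ∂sphereMeasure n :=
  (show Measurable fun p : ℝ × Metric.sphere (0 : EuclideanSpace ℝ (Fin n)) 1 =>
    h (p.1 • (p.2 : EuclideanSpace ℝ (Fin n))) from
      hh.comp (measurable_polar n)).lintegral_prod_right

lemma lintegral_unitBall (hn : 1 ≤ n) {h : EuclideanSpace ℝ (Fin n) → ℝ≥0∞} (hh : Measurable h) :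
    ∫⁻ x in unitBall n, h x =
      ∫⁻ r in Ioo (0 : ℝ) 1, ∫⁻ θ, h (r • (θ : EuclideanSpace ℝ (Fin n))) ∂sphereMeasure n
        ∂radialMeasure n := by
  have : Nonempty (Fin n) := ⟨⟨0, hn⟩⟩
  let E := EuclideanSpace ℝ (Fin n)
  set k : E → ℝ≥0∞ := (unitBall n).indicator h with hk
  have hkm : Measurable k := hh.indicator measurableSet_ball
  have hinner : Measurable fun r : ℝ => ∫⁻ θ, k (r • (θ : E)) ∂sphereMeasure n :=
    measurable_lintegral_sphere hkm
  have h1 : ∫⁻ x, k x = ∫⁻ x : ({(0 : E)}ᶜ : Set E), k x.1 ∂(volume.comap Subtype.val) := by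
    rw [lintegral_subtype_comap (measurableSet_singleton _).compl, restrict_compl_singleton]
  have h2 := (volume : Measure E).measurePreserving_homeomorphUnitSphereProd.lintegral_comp_emb
    (Homeomorph.measurableEmbedding _)
    (fun p : Metric.sphere (0 : E) 1 × Ioi (0 : ℝ) => k (p.2.1 • (p.1 : E)))
  have h3 : ∀ x : ({(0 : E)}ᶜ : Set E), ((homeomorphUnitSphereProd E x).2.1 •
      ((homeomorphUnitSphereProd E x).1 : E)) = x := fun x => by
    have := congrArg Subtype.val ((homeomorphUnitSphereProd E).symm_apply_apply x)
    rwa [homeomorphUnitSphereProd_symm_apply_coe] at this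
  simp only [h3] at h2
  rw [← lintegral_indicator (show MeasurableSet (unitBall n) from measurableSet_ball), h1, h2,
    lintegral_prod_symm' _ (by
    exact hkm.comp (by fun_prop)), Measure.volumeIoiPow,
    lintegral_withDensity_eq_lintegral_mul
      (g := fun r : Ioi (0 : ℝ) => ∫⁻ θ, k (r.1 • (θ : E)) ∂sphereMeasure n) _ (by fun_prop)
      (hinner.comp measurable_subtype_coe), radialMeasure,
    restrict_withDensity measurableSet_Ioo]
  have hdim : Module.finrank ℝ E = n := finrank_euclideanSpace_fin
  simp only [Pi.mul_apply, hdim]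
  rw [lintegral_subtype_comap measurableSet_Ioi fun r : ℝ => ENNReal.ofReal (r ^ (n - 1)) *
    ∫⁻ θ, k (r • (θ : E)) ∂sphereMeasure n]
  rw [lintegral_withDensity_eq_lintegral_mul₀' (measurable_rpow_density n).aemeasurable]
  · rw [← lintegral_indicator measurableSet_Ioi, ← lintegral_indicator measurableSet_Ioo]
    refine lintegral_congr fun r => ?_
    by_cases hr : 0 < r
    · have hnorm : ∀ θ : Metric.sphere (0 : E) 1, ‖r • (θ : E)‖ = r := fun θ => by
        rw [norm_smul, norm_eq_of_mem_sphere θ, mul_one, Real.norm_of_nonneg hr.le]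
      by_cases hr1 : r < 1
      · rw [indicator_of_mem (show r ∈ Ioi 0 from hr),
          indicator_of_mem (show r ∈ Ioo 0 1 from ⟨hr, hr1⟩), Pi.mul_apply, ← Real.rpow_natCast,
          Nat.cast_sub hn, Nat.cast_one]
        congr 1
        refine lintegral_congr fun θ => ?_
        rw [hk, indicator_of_mem (by simp [unitBall, hnorm, hr1])]
      · rw [indicator_of_mem (show r ∈ Ioi 0 from hr),
          indicator_of_notMem (fun h : r ∈ Ioo 0 1 => hr1 h.2)]
        have : ∀ θ : Metric.sphere (0 : E) 1, k (r • (θ : E)) = 0 := fun θ => by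
          rw [hk, indicator_of_notMem]
          simpa [unitBall, hnorm] using hr1
        simp [this]
    · rw [indicator_of_notMem (show r ∉ Ioi 0 from hr),
        indicator_of_notMem (fun h : r ∈ Ioo 0 1 => hr h.1)]
  · exact (measurable_lintegral_sphere hh).aemeasurable

lemma lintegral_unitBall_norm (hn : 1 ≤ n) {h : ℝ → ℝ≥0∞} (hh : Measurable h) :
    ∫⁻ x in unitBall n, h ‖x‖ =
      sphereMeasure n univ * ∫⁻ r in Ioo (0 : ℝ) 1, h r ∂radialMeasure n := by
  rw [lintegral_unitBall hn (h := fun x => h ‖x‖) (hh.comp measurable_norm), ← lintegral_const_mul _ hh]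
  refine setLIntegral_congr_fun measurableSet_Ioo fun r hr => ?_
  have : ∀ θ : Metric.sphere (0 : EuclideanSpace ℝ (Fin n)) 1,
      ‖r • (θ : EuclideanSpace ℝ (Fin n))‖ = r := fun θ => by
    rw [norm_smul, norm_eq_of_mem_sphere θ, mul_one, Real.norm_of_nonneg hr.1.le]
  simp [this, mul_comm]

lemma setLIntegral_radialMeasure {h : ℝ → ℝ≥0∞} (hh : Measurable h) {s : Set ℝ}
    (hs : MeasurableSet s) : ∫⁻ r in s, h r ∂radialMeasure n =
      ∫⁻ r in s, ENNReal.ofReal (r ^ ((n : ℝ) - 1)) * h r := by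
  rw [radialMeasure, restrict_withDensity hs,
    lintegral_withDensity_eq_lintegral_mul _ (measurable_rpow_density n) hh]
  rfl

lemma ae_radialMeasure_iff {P : ℝ → Prop} :
    (∀ᵐ r ∂(radialMeasure n).restrict (Ioo 0 1), P r) ↔ ∀ᵐ r ∂volume.restrict (Ioo 0 1), P r := by
  rw [radialMeasure, restrict_withDensity measurableSet_Ioo,
    ae_withDensity_iff (measurable_rpow_density n)]
  refine eventually_congr ?_
  filter_upwards [ae_restrict_mem measurableSet_Ioo] with r hr
  have : ENNReal.ofReal (r ^ ((n : ℝ) - 1)) ≠ 0 := by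
    simpa using Real.rpow_pos_of_pos hr.1 _
  simp [this]

/-- An almost everywhere property in the ball holds almost everywhere on almost every sphere. -/
lemma ae_ae_of_ae_unitBall (hn : 1 ≤ n) {P : EuclideanSpace ℝ (Fin n) → Prop}
    (h : ∀ᵐ x ∂volume.restrict (unitBall n), P x) :
    ∀ᵐ r ∂volume.restrict (Ioo (0 : ℝ) 1),
      ∀ᵐ θ : Metric.sphere (0 : EuclideanSpace ℝ (Fin n)) 1 ∂sphereMeasure n,
        P (r • (θ : EuclideanSpace ℝ (Fin n))) := by
  obtain ⟨t, ht, htm, ht0⟩ := exists_measurable_superset_of_null (ae_iff.1 h)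
  have hm : Measurable (t.indicator (1 : EuclideanSpace ℝ (Fin n) → ℝ≥0∞)) :=
    measurable_one.indicator htm
  have h0 : ∫⁻ x in unitBall n, t.indicator 1 x = 0 := by rw [lintegral_indicator_one htm, ht0]
  have hpm : Measurable fun p : ℝ × Metric.sphere (0 : EuclideanSpace ℝ (Fin n)) 1 =>
      t.indicator (1 : EuclideanSpace ℝ (Fin n) → ℝ≥0∞)
        (p.1 • (p.2 : EuclideanSpace ℝ (Fin n))) := hm.comp (measurable_polar n)
  rw [lintegral_unitBall hn hm, lintegral_eq_zero_iff hpm.lintegral_prod_right] at h0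
  filter_upwards [ae_radialMeasure_iff.1 h0] with r hr
  have hr := (lintegral_eq_zero_iff (hpm.comp (measurable_prodMk_left (x := r)))).1 hr
  filter_upwards [hr] with θ hθ
  by_contra hP
  simp [indicator_of_mem (ht hP)] at hθ

/-- A property of almost every radius holds for almost every point of the ball. -/
lemma ae_unitBall_of_ae (hn : 1 ≤ n) {P : ℝ → Prop}
    (h : ∀ᵐ r ∂volume.restrict (Ioo (0 : ℝ) 1), P r) :
    ∀ᵐ x ∂volume.restrict (unitBall n), P ‖x‖ := by
  obtain ⟨t, ht, htm, ht0⟩ := exists_measurable_superset_of_null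
    (ae_iff.1 (ae_radialMeasure_iff (n := n).2 h))
  have hm : Measurable (t.indicator (1 : ℝ → ℝ≥0∞)) := measurable_one.indicator htm
  have h0 : ∫⁻ x in unitBall n, t.indicator (1 : ℝ → ℝ≥0∞) ‖x‖ = 0 := by
    rw [lintegral_unitBall_norm hn hm, lintegral_indicator_one htm, ht0, mul_zero]
  filter_upwards [(lintegral_eq_zero_iff (hm.comp measurable_norm)).1 h0] with x hx
  by_contra hP
  simp [indicator_of_mem (ht hP)] at hx

end Polar

/-! ### Oscillation of smooth functions along rays -/

section Oscillation

variable {n : ℕ} {G : ℝ → ℝ}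

/-- The modular of `T t^{1-n}` for the complementary function of `G` on the annulus `r < t < s`,
in the measure `t^{n-1} dt`. -/
noncomputable def annulusModular (n : ℕ) (G : ℝ → ℝ) (T r s : ℝ) : ℝ≥0∞ :=
  ∫⁻ t in Ioo r s, ENNReal.ofReal (complementary G (T * t ^ (1 - (n : ℝ)))) ∂radialMeasure n

lemma measurable_complementary_rpow (hG : IsNFunction G) (T : ℝ) :
    Measurable fun t : ℝ => ENNReal.ofReal (complementary G (T * t ^ (1 - (n : ℝ)))) :=
  (hG.complementary_mono.measurable.comp (by fun_prop)).ennreal_ofReal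

lemma radialMeasure_Ioo_le (hn : 1 ≤ n) {r s : ℝ} (hr : 0 ≤ r) (hs : s ≤ 1) :
    radialMeasure n (Ioo r s) ≤ ENNReal.ofReal (s - r) := by
  rw [radialMeasure, withDensity_apply _ measurableSet_Ioo, ← Real.volume_Ioo, ← setLIntegral_one]
  refine setLIntegral_mono measurable_const fun t ht => ?_
  rw [← ENNReal.ofReal_one]
  refine ENNReal.ofReal_le_ofReal (Real.rpow_le_one (hr.trans ht.1.le) (ht.2.le.trans hs) ?_)
  have : (1 : ℝ) ≤ n := by exact_mod_cast hn
  linarith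

lemma annulusModular_le (hn : 1 ≤ n) (hG : IsNFunction G) {T r₀ r s : ℝ} (hT : 0 ≤ T)
    (hr₀ : 0 < r₀) (hr : r₀ ≤ r) (hs : s ≤ 1) :
    annulusModular n G T r s ≤
      ENNReal.ofReal (complementary G (T * r₀ ^ (1 - (n : ℝ)))) * ENNReal.ofReal (s - r) := by
  have hn' : (1 : ℝ) ≤ n := by exact_mod_cast hn
  calc annulusModular n G T r s
      ≤ ∫⁻ _ in Ioo r s, ENNReal.ofReal (complementary G (T * r₀ ^ (1 - (n : ℝ))))
          ∂radialMeasure n := by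
        refine setLIntegral_mono measurable_const fun t ht => ENNReal.ofReal_le_ofReal
          (hG.complementary_mono (mul_le_mul_of_nonneg_left ?_ hT))
        exact Real.rpow_le_rpow_of_nonpos hr₀ (hr.trans ht.1.le) (by linarith)
    _ ≤ _ := by
        rw [setLIntegral_const]
        gcongr
        exact radialMeasure_Ioo_le hn (hr₀.le.trans hr) hs

/-- The fundamental theorem of calculus along a ray. -/
lemma enorm_sub_le_lintegral_gradient {φ : EuclideanSpace ℝ (Fin n) → ℝ} (hφ : ContDiff ℝ ∞ φ)
    {θ : EuclideanSpace ℝ (Fin n)} (hθ : ‖θ‖ = 1) {r s : ℝ} (hrs : r ≤ s) :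
    ‖φ (r • θ) - φ (s • θ)‖ₑ ≤ ∫⁻ t in Ioo r s, ‖gradient φ (t • θ)‖ₑ := by
  have hd : ∀ t : ℝ, HasDerivAt (fun t : ℝ => φ (t • θ)) (fderiv ℝ φ (t • θ) θ) t := fun t => by
    have h1 := (hφ.differentiable (by simp) (t • θ)).hasFDerivAt
    have h2 : HasDerivAt (fun t : ℝ => t • θ) θ t := by
      simpa using (hasDerivAt_id t).smul_const θ
    exact h1.comp_hasDerivAt t h2
  have hc : Continuous fun t : ℝ => fderiv ℝ φ (t • θ) θ :=
    ((hφ.continuous_fderiv (by simp)).comp (by fun_prop)).clm_apply continuous_const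
  have hftc := intervalIntegral.integral_eq_sub_of_hasDerivAt (fun t _ => hd t)
    (hc.intervalIntegrable r s)
  rw [← enorm_neg, neg_sub, ← hftc, intervalIntegral.integral_of_le hrs]
  refine (enorm_integral_le_lintegral_enorm _).trans ?_
  rw [Measure.restrict_congr_set Ioo_ae_eq_Ioc.symm]
  refine lintegral_mono fun t => ?_
  have : ‖fderiv ℝ φ (t • θ) θ‖ ≤ ‖gradient φ (t • θ)‖ := by
    rw [gradient, LinearIsometryEquiv.norm_map]
    simpa [hθ] using (fderiv ℝ φ (t • θ)).le_opNorm θ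
  exact enorm_le_iff_norm_le.2 this

lemma continuous_gradient {φ : EuclideanSpace ℝ (Fin n) → ℝ} (hφ : ContDiff ℝ ∞ φ) :
    Continuous (gradient φ) :=
  (LinearIsometryEquiv.continuous _).comp (hφ.continuous_fderiv (by simp))

/-- The oscillation of `φ` between two concentric spheres: the difference along a ray is at most
the integral of `|∇φ| t^{1-n}` against `t^{n-1} dt`, to which Young's inequality is applied. -/
lemma lintegral_sphere_enorm_sub_le (hn : 1 ≤ n) (hG : IsNFunction G)
    {φ : EuclideanSpace ℝ (Fin n) → ℝ} (hφ : ContDiff ℝ ∞ φ) {l T r s : ℝ} (hl : 0 < l)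
    (h : ∫⁻ x in unitBall n, ENNReal.ofReal (G (‖gradient φ x‖ / l)) ≤ 1) (hT : 0 < T)
    (hr : 0 < r) (hrs : r ≤ s) (hs : s ≤ 1) :
    ∫⁻ θ, ‖φ (r • (θ : EuclideanSpace ℝ (Fin n))) - φ (s • (θ : EuclideanSpace ℝ (Fin n)))‖ₑ
        ∂sphereMeasure n ≤
      ENNReal.ofReal (l / T) * (1 + sphereMeasure n univ * annulusModular n G T r s) := by
  have hgm : Measurable fun x => ‖gradient φ x‖ₑ := (continuous_gradient hφ).measurable.enorm
  have hGm : Measurable fun x => ENNReal.ofReal (G (‖gradient φ x‖ / l)) :=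
    (hG.measurable_comp ((continuous_gradient hφ).measurable.norm.div_const l)
      fun x => by positivity).ennreal_ofReal
  calc _ ≤ ∫⁻ θ, (∫⁻ t in Ioo r s, ‖gradient φ (t • (θ : EuclideanSpace ℝ (Fin n)))‖ₑ)
          ∂sphereMeasure n := lintegral_mono fun θ =>
        enorm_sub_le_lintegral_gradient hφ (norm_eq_of_mem_sphere θ) hrs
    _ = ∫⁻ t in Ioo r s, ∫⁻ θ, ‖gradient φ (t • (θ : EuclideanSpace ℝ (Fin n)))‖ₑ
          ∂sphereMeasure n := lintegral_lintegral_swap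
        (f := fun (θ : Metric.sphere (0 : EuclideanSpace ℝ (Fin n)) 1) (t : ℝ) =>
          ‖gradient φ (t • (θ : EuclideanSpace ℝ (Fin n)))‖ₑ)
        ((hgm.comp ((measurable_polar n).comp measurable_swap)).aemeasurable)
    _ = ∫⁻ t in Ioo r s, ENNReal.ofReal (t ^ (1 - (n : ℝ))) *
          ∫⁻ θ, ‖gradient φ (t • (θ : EuclideanSpace ℝ (Fin n)))‖ₑ
            ∂sphereMeasure n ∂radialMeasure n := by
        rw [setLIntegral_radialMeasure (h := fun t : ℝ => ENNReal.ofReal (t ^ (1 - (n : ℝ))) *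
            ∫⁻ θ, ‖gradient φ (t • (θ : EuclideanSpace ℝ (Fin n)))‖ₑ ∂sphereMeasure n)
          ((by fun_prop : Measurable fun t : ℝ => ENNReal.ofReal (t ^ (1 - (n : ℝ)))).mul
            (measurable_lintegral_sphere hgm)) measurableSet_Ioo]
        refine setLIntegral_congr_fun measurableSet_Ioo fun t ht => ?_
        have ht0 : 0 < t := hr.trans ht.1
        rw [← mul_assoc, ← ENNReal.ofReal_mul (by positivity), ← Real.rpow_add ht0]
        simp
    _ ≤ ∫⁻ t in Ioo r s, ENNReal.ofReal (l / T) *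
          ((∫⁻ θ, ENNReal.ofReal (G (‖gradient φ (t • (θ : EuclideanSpace ℝ (Fin n)))‖ / l))
            ∂sphereMeasure n) + sphereMeasure n univ *
            ENNReal.ofReal (complementary G (T * t ^ (1 - (n : ℝ))))) ∂radialMeasure n := by
        refine setLIntegral_mono' measurableSet_Ioo fun t ht => ?_
        have ht0 : 0 < t := hr.trans ht.1
        rw [← lintegral_const_mul' _ _ ENNReal.ofReal_ne_top,
          mul_comm (sphereMeasure n univ), ← lintegral_const,
          ← lintegral_add_right _ measurable_const, ← lintegral_const_mul' _ _ ENNReal.ofReal_ne_top]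
        refine lintegral_mono fun θ => ?_
        refine le_trans (le_of_eq ?_) (mul_le_mul_right (hG.mul_le_add_complementary
          (T * t ^ (1 - (n : ℝ))) (show 0 ≤ ‖gradient φ (t • (θ : EuclideanSpace ℝ (Fin n)))‖ / l
            by positivity)) _)
        rw [← ofReal_norm, ← ENNReal.ofReal_mul (by positivity),
          ← ENNReal.ofReal_mul (by positivity)]
        congr 1
        field_simp
    _ = ENNReal.ofReal (l / T) * ((∫⁻ t in Ioo r s,
          ∫⁻ θ, ENNReal.ofReal (G (‖gradient φ (t • (θ : EuclideanSpace ℝ (Fin n)))‖ / l))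
            ∂sphereMeasure n ∂radialMeasure n) +
          sphereMeasure n univ * annulusModular n G T r s) := by
        rw [lintegral_const_mul' _ _ ENNReal.ofReal_ne_top,
          lintegral_add_left (measurable_lintegral_sphere hGm),
          lintegral_const_mul _ (measurable_complementary_rpow hG T), annulusModular]
    _ ≤ _ := by
        gcongr
        refine le_trans ?_ ((lintegral_unitBall hn hGm).symm.le.trans h)
        exact lintegral_mono_set (Ioo_subset_Ioo hr.le hs)

end Oscillation

/-! ### The radial profile -/

section Profile

variable {n : ℕ} {G : ℝ → ℝ}

/-- The Luxemburg norm of `s^{1-n}` on `(r, 1)` before conversion to a real number. -/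
noncomputable def radialNorm (n : ℕ) (G : ℝ → ℝ) (r : ℝ) : ℝ≥0∞ :=
  luxNorm (complementary G) ((radialMeasure n).restrict (Ioo r 1)) fun s : ℝ => s ^ (1 - (n : ℝ))

lemma radialProfile_eq (n : ℕ) (G : ℝ → ℝ) (r : ℝ) :
    radialProfile n G r = (radialNorm n G r).toReal := by
  rw [radialProfile, radialNorm, radialMeasure, restrict_withDensity measurableSet_Ioo]

lemma radialProfile_nonneg (n : ℕ) (G : ℝ → ℝ) (r : ℝ) : 0 ≤ radialProfile n G r :=
  ENNReal.toReal_nonneg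

lemma measurable_radialProfile (n : ℕ) (G : ℝ → ℝ) : Measurable (radialProfile n G) := by
  have : Antitone (radialNorm n G) := fun r s hrs =>
    luxNorm_mono_measure (Measure.restrict_mono (Ioo_subset_Ioo_left hrs) le_rfl)
  simp_rw [funext (radialProfile_eq n G)]
  exact this.measurable.ennreal_toReal

lemma lintegral_complementary_div {r : ℝ} (hr : 0 < r) (N : ℝ) :
    ∫⁻ s in Ioo r 1, ENNReal.ofReal (complementary G (‖s ^ (1 - (n : ℝ))‖ / N)) ∂radialMeasure n
      = annulusModular n G N⁻¹ r 1 := by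
  refine setLIntegral_congr_fun measurableSet_Ioo fun s hs => ?_
  rw [Real.norm_of_nonneg (Real.rpow_nonneg (hr.trans hs.1).le _), div_eq_inv_mul]

lemma radialNorm_lt_top (hn : 1 ≤ n) (hG : IsNFunction G) {r : ℝ} (hr : 0 < r) :
    radialNorm n G r < ⊤ := by
  refine luxNorm_lt_top (fun c t h0 h1 _ => hG.complementary_le_mul h0 h1 t) ?_
  have := lintegral_complementary_div (n := n) (G := G) hr 1
  simp only [div_one] at this
  rw [modular, this, inv_one]
  exact (annulusModular_le hn hG zero_le_one hr le_rfl le_rfl).trans_lt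
    (ENNReal.mul_lt_top ENNReal.ofReal_lt_top ENNReal.ofReal_lt_top)

lemma annulusModular_le_one (hn : 1 ≤ n) (hG : IsNFunction G) {r N : ℝ} (hr : 0 < r)
    (hN : radialProfile n G r < N) : 0 < N ∧ annulusModular n G N⁻¹ r 1 ≤ 1 := by
  rw [radialProfile_eq, ← ENNReal.lt_ofReal_iff_toReal_lt (radialNorm_lt_top hn hG hr).ne] at hN
  rw [← lintegral_complementary_div hr N]
  exact lintegral_le_one_of_luxNorm_lt (hG.complementary_mono.monotoneOn _) hN

end Profile

/-! ### Radial functions in the closure of the test functions -/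

section Radial

variable {n : ℕ} {G : ℝ → ℝ} {u : EuclideanSpace ℝ (Fin n) → ℝ} {f : ℝ → ℝ}

/-- Test functions approximating a radial `u = f(|x|)` in the Orlicz-Sobolev norm fast enough that
they also converge to `f r` in mean over almost every sphere of radius `r`. -/
lemma exists_testFunction_tendsto_sphere (hn : 1 ≤ n) (hG : IsNFunction G)
    (hu : MemW10 G (unitBall n) u)
    (hf : u =ᵐ[volume.restrict (unitBall n)] fun x => f ‖x‖) :
    ∃ v : ℕ → EuclideanSpace ℝ (Fin n) → ℝ, (∀ j, IsTestFunction (unitBall n) (v j)) ∧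
      Tendsto (fun j => luxNorm G (volume.restrict (unitBall n))
        (fun x => weakGradient (unitBall n) u x - gradient (v j) x)) atTop (𝓝 0) ∧
      ∀ᵐ r ∂volume.restrict (Ioo (0 : ℝ) 1), Tendsto
        (fun j => ∫⁻ θ, ‖f r - v j (r • (θ : EuclideanSpace ℝ (Fin n)))‖ₑ ∂sphereMeasure n)
        atTop (𝓝 0) := by
  have hpos : ∀ j : ℕ, 0 < ENNReal.ofReal ((1 / 2 : ℝ) ^ j) := fun j =>
    ENNReal.ofReal_pos.2 (by positivity)
  choose v hv hlt using fun j => hu.2 _ (hpos j)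
  refine ⟨v, hv, ?_, ?_⟩
  · have hlim : Tendsto (fun j : ℕ => ENNReal.ofReal ((1 / 2 : ℝ) ^ j)) atTop (𝓝 0) := by
      have := tendsto_pow_atTop_nhds_zero_of_lt_one (r := (1 / 2 : ℝ)) (by norm_num) (by norm_num)
      simpa using ENNReal.tendsto_ofReal this
    exact tendsto_of_tendsto_of_tendsto_of_le_of_le tendsto_const_nhds hlim
      (fun _ => zero_le) fun j => le_add_self.trans (hlt j).le
  have hum := hu.1.1.1
  set w := hum.mk u with hw
  have hwm : Measurable w := hum.stronglyMeasurable_mk.measurable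
  have huw : u =ᵐ[volume.restrict (unitBall n)] w := hum.ae_eq_mk
  set K : ℝ≥0∞ := 1 + ENNReal.ofReal (complementary G 1) *
    (volume.restrict (unitBall n) : Measure (EuclideanSpace ℝ (Fin n))) univ with hK
  have hKtop : K ≠ ⊤ := by
    rw [hK, Measure.restrict_apply_univ]
    exact ENNReal.add_ne_top.2 ⟨ENNReal.one_ne_top, ENNReal.mul_ne_top ENNReal.ofReal_ne_top
      measure_ball_lt_top.ne⟩
  have hvm : ∀ j, Measurable fun x => ‖w x - v j x‖ₑ := fun j =>
    (hwm.sub (hv j).1.continuous.measurable).enorm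
  have hL1 : ∀ j, ∫⁻ x in unitBall n, ‖w x - v j x‖ₑ ≤ ENNReal.ofReal ((1 / 2 : ℝ) ^ j) * K := by
    intro j
    refine le_trans (le_of_eq (lintegral_congr_ae ?_))
      (lintegral_enorm_le_of_luxNorm_lt hG (le_self_add.trans_lt (hlt j)))
    filter_upwards [huw] with x hx
    rw [hx]
  have hsum : ∫⁻ r in Ioo (0 : ℝ) 1, ∑' j, ∫⁻ θ, ‖w (r • (θ : EuclideanSpace ℝ (Fin n))) -
      v j (r • (θ : EuclideanSpace ℝ (Fin n)))‖ₑ ∂sphereMeasure n ∂radialMeasure n ≠ ⊤ := by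
    rw [lintegral_tsum fun j => (measurable_lintegral_sphere (hvm j)).aemeasurable]
    refine ne_top_of_le_ne_top ?_
      (ENNReal.tsum_le_tsum fun j => (lintegral_unitBall hn (hvm j)).symm.le.trans (hL1 j))
    rw [ENNReal.tsum_mul_right]
    refine ENNReal.mul_ne_top ?_ hKtop
    rw [← ENNReal.ofReal_tsum_of_nonneg (fun j => by positivity) summable_geometric_two]
    exact ENNReal.ofReal_ne_top
  have hae := ae_radialMeasure_iff.1 (ae_lt_top'
    (Measurable.tsum fun j => measurable_lintegral_sphere (hvm j)).aemeasurable hsum)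
  filter_upwards [hae, ae_ae_of_ae_unitBall hn (hf.symm.trans huw),
    ae_restrict_mem measurableSet_Ioo] with r hr hfr hr01
  refine (ENNReal.tendsto_atTop_zero_of_tsum_ne_top hr.ne).congr fun j => lintegral_congr_ae ?_
  filter_upwards [hfr] with θ hθ
  rw [← hθ, norm_smul, norm_eq_of_mem_sphere θ, mul_one, Real.norm_of_nonneg hr01.1.le]

/-- If `∇φ_j → w` in `L^G`, the oscillations of the `φ_j` between two spheres are eventually
controlled by the norm of `w`. -/
lemma eventually_lintegral_sphere_enorm_sub_le (hn : 1 ≤ n) (hG : IsNFunction G)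
    {w : EuclideanSpace ℝ (Fin n) → EuclideanSpace ℝ (Fin n)}
    {φ : ℕ → EuclideanSpace ℝ (Fin n) → ℝ} (hφ : ∀ j, ContDiff ℝ ∞ (φ j))
    (hw : AEStronglyMeasurable w (volume.restrict (unitBall n)))
    (hlim : Tendsto (fun j => luxNorm G (volume.restrict (unitBall n))
        (fun x => w x - gradient (φ j) x)) atTop (𝓝 0)) {l : ℝ}
    (hl : luxNorm G (volume.restrict (unitBall n)) w < ENNReal.ofReal l) :
    ∀ᶠ j in atTop, ∀ T r s : ℝ, 0 < T → 0 < r → r ≤ s → s ≤ 1 →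
      ∫⁻ θ, ‖φ j (r • (θ : EuclideanSpace ℝ (Fin n))) -
          φ j (s • (θ : EuclideanSpace ℝ (Fin n)))‖ₑ ∂sphereMeasure n ≤
        ENNReal.ofReal (l / T) * (1 + sphereMeasure n univ * annulusModular n G T r s) := by
  have hadd : Tendsto (fun j => luxNorm G (volume.restrict (unitBall n))
      (fun x => w x - gradient (φ j) x) + luxNorm G (volume.restrict (unitBall n)) w) atTop
      (𝓝 (luxNorm G (volume.restrict (unitBall n)) w)) := by
    simpa using hlim.add_const (luxNorm G (volume.restrict (unitBall n)) w)
  filter_upwards [hadd.eventually_lt_const hl] with j hj T r s hT hr hrs hs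
  refine lintegral_sphere_enorm_sub_le hn hG (hφ j)
    (ENNReal.ofReal_pos.1 (pos_of_gt hl)) ?_ hT hr hrs hs
  refine (lintegral_le_one_of_luxNorm_lt hG.monotoneOn (lt_of_le_of_lt ?_ hj)).2
  have hsum : gradient (φ j) = w + fun x => gradient (φ j) x - w x := by
    ext1 x
    simp
  rw [luxNorm_sub_comm, add_comm]
  exact (congrArg _ hsum).trans_le (luxNorm_add_le hG hw)

/-- The constant in the pointwise bound for radial functions. -/
noncomputable def radialConst (n : ℕ) : ℝ := 1 + ((sphereMeasure n).real univ)⁻¹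

lemma sphereMeasure_real_pos (hn : 1 ≤ n) : 0 < (sphereMeasure n).real univ :=
  ENNReal.toReal_pos (sphereMeasure_univ_ne_zero hn) (measure_ne_top _ _)

lemma radialConst_pos (n : ℕ) : 0 < radialConst n := by
  have : 0 ≤ (sphereMeasure n).real univ := measureReal_nonneg
  unfold radialConst
  positivity

/-- The pointwise bound: `u` is bounded by a constant plus the radial profile times the distance of
`∇u` to the gradient of a test function. Since that distance can be made arbitrarily small, this is
sharp enough to bound the modular itself, without a doubling condition. -/
lemma ae_abs_le_add_radialProfile (hn : 1 ≤ n) (hG : IsNFunction G)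
    (hu : MemW10 G (unitBall n) u)
    (hf : u =ᵐ[volume.restrict (unitBall n)] fun x => f ‖x‖)
    {ψ : EuclideanSpace ℝ (Fin n) → ℝ} (hψ : IsTestFunction (unitBall n) ψ) {K : ℝ}
    (hK : ∀ x, |ψ x| ≤ K) {l : ℝ}
    (hl : luxNorm G (volume.restrict (unitBall n))
      (fun x => weakGradient (unitBall n) u x - gradient ψ x) < ENNReal.ofReal l) :
    ∀ᵐ r ∂volume.restrict (Ioo (0 : ℝ) 1),
      |f r| ≤ K + radialConst n * (l * radialProfile n G r) := by
  obtain ⟨v, hv, hlim, hae⟩ := exists_testFunction_tendsto_sphere hn hG hu hf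
  have hl0 : 0 < l := ENNReal.ofReal_pos.1 (pos_of_gt hl)
  have hgrad : ∀ j x, gradient (fun y => v j y - ψ y) x = gradient (v j) x - gradient ψ x := by
    intro j x
    rw [gradient, fderiv_fun_sub ((hv j).1.differentiable (by simp) x)
      (hψ.1.differentiable (by simp) x), map_sub]
    rfl
  have hev := eventually_lintegral_sphere_enorm_sub_le hn hG (φ := fun j x => v j x - ψ x)
    (fun j => (hv j).1.sub hψ.1)
    (hu.1.2.2.1.sub (continuous_gradient hψ.1).aestronglyMeasurable)
    (by simpa only [hgrad, Pi.sub_apply, sub_sub_sub_cancel_right] using hlim) hl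
  set σ := (sphereMeasure n).real univ with hσ
  have hσ0 : 0 < σ := sphereMeasure_real_pos hn
  have hσE : sphereMeasure n univ = ENNReal.ofReal σ := (ofReal_measureReal).symm
  have hK0 : 0 ≤ K := (abs_nonneg _).trans (hK 0)
  filter_upwards [hae, ae_restrict_mem measurableSet_Ioo] with r hr hr01
  -- the bound with every `N` above the radial profile in place of the profile itself
  have key : ∀ N, radialProfile n G r < N → |f r| ≤ K + radialConst n * (l * N) := by
    intro N hN
    obtain ⟨hN0, hN1⟩ := annulusModular_le_one hn hG hr01.1 hN
    have hlim2 := hr.add_const (ENNReal.ofReal (l / N⁻¹) *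
      (1 + sphereMeasure n univ * annulusModular n G N⁻¹ r 1) +
        sphereMeasure n univ * ENNReal.ofReal K)
    rw [zero_add] at hlim2
    have hbound : sphereMeasure n univ * ‖f r‖ₑ ≤ ENNReal.ofReal (l / N⁻¹) *
        (1 + sphereMeasure n univ * annulusModular n G N⁻¹ r 1) +
        sphereMeasure n univ * ENNReal.ofReal K := by
      refine ge_of_tendsto hlim2 ?_
      filter_upwards [hev] with j hj
      have hm : ∀ {φ : EuclideanSpace ℝ (Fin n) → ℝ}, ContDiff ℝ ∞ φ →
          Measurable fun θ : Metric.sphere (0 : EuclideanSpace ℝ (Fin n)) 1 =>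
            φ (r • (θ : EuclideanSpace ℝ (Fin n))) := fun h =>
        (h.continuous.comp (by fun_prop)).measurable
      -- test functions vanish on the unit sphere
      have hzero : ∀ {φ}, IsTestFunction (unitBall n) φ →
          ∀ θ : Metric.sphere (0 : EuclideanSpace ℝ (Fin n)) 1,
            φ ((1 : ℝ) • (θ : EuclideanSpace ℝ (Fin n))) = 0 := fun hφ θ => by
        refine image_eq_zero_of_notMem_tsupport fun h => ?_
        have := hφ.2.2 h
        simp [unitBall] at this
      have hj' := hj N⁻¹ r 1 (by positivity) hr01.1 hr01.2.le le_rfl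
      simp only [hzero (hv j), hzero hψ, sub_zero] at hj'
      calc sphereMeasure n univ * ‖f r‖ₑ = ∫⁻ θ, ‖f r‖ₑ ∂sphereMeasure n := by
            rw [lintegral_const, mul_comm]
        _ ≤ ∫⁻ θ, (‖f r - v j (r • (θ : EuclideanSpace ℝ (Fin n)))‖ₑ +
              (‖v j (r • (θ : EuclideanSpace ℝ (Fin n))) -
                ψ (r • (θ : EuclideanSpace ℝ (Fin n)))‖ₑ + ENNReal.ofReal K))
                ∂sphereMeasure n := by
            refine lintegral_mono fun θ => ?_
            set a := v j (r • (θ : EuclideanSpace ℝ (Fin n)))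
            set b := ψ (r • (θ : EuclideanSpace ℝ (Fin n)))
            have hb : ‖b‖ₑ ≤ ENNReal.ofReal K := by
              rw [← ofReal_norm]
              exact ENNReal.ofReal_le_ofReal (hK _)
            have : f r = (f r - a) + ((a - b) + b) := by ring
            calc ‖f r‖ₑ = ‖(f r - a) + ((a - b) + b)‖ₑ := by rw [← this]
              _ ≤ ‖f r - a‖ₑ + (‖a - b‖ₑ + ‖b‖ₑ) :=
                (enorm_add_le _ _).trans (by gcongr; exact enorm_add_le _ _)
              _ ≤ _ := by gcongr
        _ = (∫⁻ θ, ‖f r - v j (r • (θ : EuclideanSpace ℝ (Fin n)))‖ₑ ∂sphereMeasure n) +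
              ((∫⁻ θ, ‖v j (r • (θ : EuclideanSpace ℝ (Fin n))) -
                ψ (r • (θ : EuclideanSpace ℝ (Fin n)))‖ₑ ∂sphereMeasure n) +
              sphereMeasure n univ * ENNReal.ofReal K) := by
            rw [lintegral_add_left (by exact ((hm (hv j).1).const_sub _).enorm),
              lintegral_add_right _ measurable_const, lintegral_const,
              mul_comm (ENNReal.ofReal K)]
        _ ≤ _ := by gcongr
    have hreal : ENNReal.ofReal (σ * |f r|) ≤ ENNReal.ofReal (l * N * (1 + σ) + σ * K) := by
      rw [ENNReal.ofReal_add (by positivity) (by positivity), ENNReal.ofReal_mul hσ0.le,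
        ENNReal.ofReal_mul (by positivity : (0 : ℝ) ≤ l * N), ENNReal.ofReal_mul hσ0.le,
        ENNReal.ofReal_add zero_le_one hσ0.le, ENNReal.ofReal_one, ← Real.norm_eq_abs, ofReal_norm,
        ← hσE]
      refine hbound.trans ?_
      rw [div_inv_eq_mul]
      gcongr
      exact mul_le_of_le_one_right' hN1
    have h2 := (ENNReal.ofReal_le_ofReal_iff (by positivity)).1 hreal
    have h3 : K + radialConst n * (l * N) = σ⁻¹ * (l * N * (1 + σ) + σ * K) := by
      rw [radialConst, ← hσ]
      field_simp
      ring
    rw [h3, ← div_eq_inv_mul, le_div_iff₀ hσ0, mul_comm]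
    exact h2
  have hcont : Tendsto (fun N => K + radialConst n * (l * N)) (𝓝[>] radialProfile n G r)
      (𝓝 (K + radialConst n * (l * radialProfile n G r))) :=
    (Continuous.tendsto (by fun_prop) _).mono_left nhdsWithin_le_nhds
  exact ge_of_tendsto hcont (eventually_nhdsWithin_of_forall key)

/-- Equicontinuity away from the origin: on almost every radius, the oscillation of a radial
function is controlled by the norm of its gradient alone. -/
lemma exists_ae_oscillation_le (hn : 1 ≤ n) (hG : IsNFunction G)
    (hu : MemW10 G (unitBall n) u)
    (hf : u =ᵐ[volume.restrict (unitBall n)] fun x => f ‖x‖) :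
    ∃ P : ℝ → Prop, (∀ᵐ r ∂volume.restrict (Ioo (0 : ℝ) 1), P r) ∧
      ∀ l T r s : ℝ, luxNorm G (volume.restrict (unitBall n)) (weakGradient (unitBall n) u) <
          ENNReal.ofReal l → 0 < T → P r → P s → 0 < r → r ≤ s → s ≤ 1 →
        sphereMeasure n univ * ‖f r - f s‖ₑ ≤
          ENNReal.ofReal (l / T) * (1 + sphereMeasure n univ * annulusModular n G T r s) := by
  obtain ⟨v, hv, hlim, hae⟩ := exists_testFunction_tendsto_sphere hn hG hu hf
  refine ⟨_, hae, fun l T r s hl hT hr hs hr0 hrs hs1 => ?_⟩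
  have hev := eventually_lintegral_sphere_enorm_sub_le hn hG (fun j => (hv j).1) hu.1.2.2.1 hlim hl
  have hlim2 := (hr.add_const (ENNReal.ofReal (l / T) *
    (1 + sphereMeasure n univ * annulusModular n G T r s))).add hs
  rw [zero_add, add_zero] at hlim2
  refine ge_of_tendsto hlim2 ?_
  filter_upwards [hev] with j hj
  have hm : ∀ r : ℝ, Measurable fun θ : Metric.sphere (0 : EuclideanSpace ℝ (Fin n)) 1 =>
      v j (r • (θ : EuclideanSpace ℝ (Fin n))) := fun r =>
    ((hv j).1.continuous.comp (by fun_prop)).measurable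
  calc sphereMeasure n univ * ‖f r - f s‖ₑ = ∫⁻ θ, ‖f r - f s‖ₑ ∂sphereMeasure n := by
        rw [lintegral_const, mul_comm]
    _ ≤ ∫⁻ θ, (‖f r - v j (r • (θ : EuclideanSpace ℝ (Fin n)))‖ₑ +
          ‖v j (r • (θ : EuclideanSpace ℝ (Fin n))) - v j (s • (θ : EuclideanSpace ℝ (Fin n)))‖ₑ +
          ‖f s - v j (s • (θ : EuclideanSpace ℝ (Fin n)))‖ₑ) ∂sphereMeasure n := by
        refine lintegral_mono fun θ => ?_
        set a := v j (r • (θ : EuclideanSpace ℝ (Fin n)))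
        set b := v j (s • (θ : EuclideanSpace ℝ (Fin n)))
        have : f r - f s = (f r - a) + (a - b) + -(f s - b) := by ring
        rw [this]
        refine (enorm_add_le _ _).trans ?_
        rw [enorm_neg]
        gcongr
        exact enorm_add_le _ _
    _ = (∫⁻ θ, ‖f r - v j (r • (θ : EuclideanSpace ℝ (Fin n)))‖ₑ ∂sphereMeasure n) +
          (∫⁻ θ, ‖v j (r • (θ : EuclideanSpace ℝ (Fin n))) -
            v j (s • (θ : EuclideanSpace ℝ (Fin n)))‖ₑ ∂sphereMeasure n) +
          ∫⁻ θ, ‖f s - v j (s • (θ : EuclideanSpace ℝ (Fin n)))‖ₑ ∂sphereMeasure n := by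
        rw [lintegral_add_left (by
            exact (((hm r).const_sub _).enorm).add (((hm r).sub (hm s)).enorm)),
          lintegral_add_left (by exact ((hm r).const_sub _).enorm)]
    _ ≤ _ := by gcongr; exact hj T r s hT hr0 hrs hs1

end Radial

/-! ### Integration against the Hénon weight -/

section Henon

variable {n : ℕ} {α : ℝ} {G : ℝ → ℝ}

lemma measurable_henon_density (n : ℕ) (α : ℝ) :
    Measurable fun x : EuclideanSpace ℝ (Fin n) => ENNReal.ofReal (‖x‖ ^ α) := by fun_prop

lemma henonMeasure_absolutelyContinuous :
    henonMeasure n α ≪ volume.restrict (unitBall n) :=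
  withDensity_absolutelyContinuous _ _

lemma henonMeasure_univ_lt_top (hα : 0 < α) : henonMeasure n α univ < ⊤ := by
  rw [henonMeasure, withDensity_apply _ MeasurableSet.univ, Measure.restrict_univ]
  calc ∫⁻ x in unitBall n, ENNReal.ofReal (‖x‖ ^ α) ≤ ∫⁻ _ in unitBall n, 1 := by
        refine setLIntegral_mono measurable_const fun x hx => ?_
        rw [← ENNReal.ofReal_one]
        refine ENNReal.ofReal_le_ofReal (Real.rpow_le_one (norm_nonneg _) ?_ hα.le)
        exact (by simpa [unitBall] using hx : ‖x‖ < 1).le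
    _ < ⊤ := by
        rw [setLIntegral_one]
        exact measure_ball_lt_top

lemma lintegral_henonMeasure_norm (hn : 1 ≤ n) {h : ℝ → ℝ≥0∞} (hh : Measurable h) :
    ∫⁻ x, h ‖x‖ ∂henonMeasure n α = sphereMeasure n univ *
      ∫⁻ r in Ioo (0 : ℝ) 1, ENNReal.ofReal (r ^ (α + (n : ℝ) - 1)) * h r := by
  rw [henonMeasure, lintegral_withDensity_eq_lintegral_mul
    (g := fun x => h ‖x‖) _ (measurable_henon_density n α) (hh.comp measurable_norm)]
  have hm : Measurable fun r : ℝ => ENNReal.ofReal (r ^ α) * h r :=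
    (by fun_prop : Measurable fun r : ℝ => ENNReal.ofReal (r ^ α)).mul hh
  refine (lintegral_unitBall_norm hn hm).trans ?_
  rw [setLIntegral_radialMeasure hm measurableSet_Ioo]
  congr 1
  refine setLIntegral_congr_fun measurableSet_Ioo fun r hr => ?_
  have hr0 : (0 : ℝ) < r := hr.1
  rw [← mul_assoc, ← ENNReal.ofReal_mul (by positivity), ← Real.rpow_add hr0]
  ring_nf

lemma lintegral_radialProfile_lt_top (hn : 1 ≤ n) {A : ℝ → ℝ} (hA : IsNFunction A)
    (h : IntegrabilityCondition n α G A) :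
    ∫⁻ x, ENNReal.ofReal (A (radialProfile n G ‖x‖)) ∂henonMeasure n α < ⊤ := by
  rw [lintegral_henonMeasure_norm (h := fun r => ENNReal.ofReal (A (radialProfile n G r))) hn
    (hA.measurable_comp (measurable_radialProfile n G) (radialProfile_nonneg n G)).ennreal_ofReal]
  refine ENNReal.mul_lt_top (measure_lt_top _ _) (lt_of_le_of_lt (le_of_eq ?_) h)
  refine setLIntegral_congr_fun measurableSet_Ioo fun r hr => ?_
  rw [ENNReal.ofReal_mul (Real.rpow_nonneg (le_of_lt hr.1) _)]

/-- A function growing essentially more slowly than `R` is integrable along every multiple of the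
radial profile. -/
lemma lintegral_mul_radialProfile_lt_top (hα : 0 < α) {H R : ℝ → ℝ}
    (hH : IsNFunction H) (hR : IsNFunction R) (hHR : EssentiallySlower H R)
    (h : ∫⁻ x, ENNReal.ofReal (R (radialProfile n G ‖x‖)) ∂henonMeasure n α < ⊤)
    {k : ℝ} (hk : 0 < k) :
    ∫⁻ x, ENNReal.ofReal (H (k * radialProfile n G ‖x‖)) ∂henonMeasure n α < ⊤ := by
  obtain ⟨t₀, ht₀⟩ := eventually_atTop.1 (((hHR k hk).eventually_lt_const one_pos).and
    (eventually_gt_atTop 0))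
  have ht₀0 := (ht₀ t₀ le_rfl).2
  calc _ ≤ ∫⁻ x, (ENNReal.ofReal (R (radialProfile n G ‖x‖)) + ENNReal.ofReal (H (k * t₀)))
        ∂henonMeasure n α := by
        refine lintegral_mono fun x => ?_
        rcases le_total (radialProfile n G ‖x‖) t₀ with hle | hle
        · refine le_add_left (ENNReal.ofReal_le_ofReal (hH.monotoneOn (mem_Ici.2 ?_)
            (mem_Ici.2 (by positivity)) (by gcongr)))
          exact mul_nonneg hk.le (radialProfile_nonneg _ _ _)
        · refine le_add_right (ENNReal.ofReal_le_ofReal ?_)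
          obtain ⟨h1, h2⟩ := ht₀ _ hle
          exact ((div_lt_one (hR.pos h2)).1 h1).le
    _ < ⊤ := by
        rw [lintegral_add_right _ measurable_const, lintegral_const]
        exact ENNReal.add_lt_top.2 ⟨h, ENNReal.mul_lt_top ENNReal.ofReal_lt_top
          (henonMeasure_univ_lt_top hα)⟩

end Henon

/-! ### Continuity of the inclusion -/

section Continuity

variable {n : ℕ} {α : ℝ} {G : ℝ → ℝ} {u : EuclideanSpace ℝ (Fin n) → ℝ}

lemma luxNorm_weakGradient_lt_top (hG : IsNFunction G) (hu : MemW1 G (unitBall n) u) :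
    luxNorm G (volume.restrict (unitBall n)) (weakGradient (unitBall n) u) < ⊤ :=
  luxNorm_lt_top (fun _ _ h0 h1 ht => hG.le_mul h0 h1 ht) hu.2.2.2

lemma ae_abs_le_radialProfile (hn : 1 ≤ n) (hG : IsNFunction G) {f : ℝ → ℝ}
    (hu : MemW10 G (unitBall n) u)
    (hf : u =ᵐ[volume.restrict (unitBall n)] fun x => f ‖x‖) {l : ℝ}
    (hl : luxNorm G (volume.restrict (unitBall n)) (weakGradient (unitBall n) u) <
      ENNReal.ofReal l) :
    ∀ᵐ r ∂volume.restrict (Ioo (0 : ℝ) 1), |f r| ≤ radialConst n * (l * radialProfile n G r) := by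
  have h0 : IsTestFunction (unitBall n) (fun _ => 0) :=
    ⟨contDiff_const, HasCompactSupport.zero, by
      rw [show tsupport (fun _ : EuclideanSpace ℝ (Fin n) => (0 : ℝ)) = ∅ from
        tsupport_eq_empty_iff.2 rfl]
      exact empty_subset _⟩
  have := ae_abs_le_add_radialProfile hn hG hu hf h0 (K := 0) (by simp) (l := l)
    (by simpa [gradient_fun_const] using hl)
  simpa using this

lemma ae_henonMeasure_of_ae (hn : 1 ≤ n) {f : ℝ → ℝ}
    (hf : u =ᵐ[volume.restrict (unitBall n)] fun x => f ‖x‖) {P : ℝ → ℝ → Prop}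
    (h : ∀ᵐ r ∂volume.restrict (Ioo (0 : ℝ) 1), P r (f r)) :
    ∀ᵐ x ∂henonMeasure n α, P ‖x‖ (u x) := by
  refine henonMeasure_absolutelyContinuous.ae_le ?_
  filter_upwards [hf, ae_unitBall_of_ae hn h] with x hx hP
  rwa [hx]

lemma continuousInclusion_of_lintegral_lt_top (hn : 1 ≤ n) (hα : 0 < α) (hG : IsNFunction G)
    {A : ℝ → ℝ} (hA : IsNFunction A)
    (h : ∫⁻ x, ENNReal.ofReal (A (radialProfile n G ‖x‖)) ∂henonMeasure n α < ⊤) :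
    ContinuousInclusion n G A (henonMeasure n α) := by
  have hc := radialConst_pos n
  refine ⟨fun u hu => ⟨hu.1.1.1.1.mono_ac henonMeasure_absolutelyContinuous, ?_⟩, ?_⟩
  · obtain ⟨hu, f, hf⟩ := hu
    -- half of the profile is absorbed by `A (radialProfile)`, the bounded part by a constant
    obtain ⟨ψ, hψ, hlt⟩ := hu.2 (ENNReal.ofReal (2 * radialConst n)⁻¹)
      (ENNReal.ofReal_pos.2 (by positivity))
    obtain ⟨K, hK⟩ := hψ.1.continuous.bounded_above_of_compact_support hψ.2.1
    have hK0 : 0 ≤ K := (norm_nonneg _).trans (hK 0)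
    have hae := ae_henonMeasure_of_ae (α := α) hn hf
      (P := fun r y => |y| ≤ K + radialConst n * ((2 * radialConst n)⁻¹ * radialProfile n G r))
      (ae_abs_le_add_radialProfile hn hG hu hf hψ hK (le_add_self.trans_lt hlt))
    calc modular A (henonMeasure n α) u
        ≤ ∫⁻ x, (ENNReal.ofReal (A (radialProfile n G ‖x‖)) + ENNReal.ofReal (A (2 * K)))
            ∂henonMeasure n α := by
          refine lintegral_mono_ae ?_
          filter_upwards [hae] with x hx
          have hp := radialProfile_nonneg n G ‖x‖
          have hx' : ‖u x‖ ≤ K + radialProfile n G ‖x‖ / 2 := by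
            rw [Real.norm_eq_abs]
            convert hx using 2
            field_simp
          rcases le_total (radialProfile n G ‖x‖) (2 * K) with hle | hle
          · exact le_add_left (ENNReal.ofReal_le_ofReal (hA.monotoneOn
              (mem_Ici.2 (norm_nonneg _)) (mem_Ici.2 (by positivity)) (by linarith)))
          · exact le_add_right (ENNReal.ofReal_le_ofReal (hA.monotoneOn
              (mem_Ici.2 (norm_nonneg _)) (mem_Ici.2 hp) (by linarith)))
      _ < ⊤ := by
          rw [lintegral_add_right _ measurable_const, lintegral_const]
          exact ENNReal.add_lt_top.2 ⟨h, ENNReal.mul_lt_top ENNReal.ofReal_lt_top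
            (henonMeasure_univ_lt_top hα)⟩
  · have hfin : luxNorm A (henonMeasure n α) (fun x => radialProfile n G ‖x‖) < ⊤ := by
      refine luxNorm_lt_top (fun _ _ h0 h1 ht => hA.le_mul h0 h1 ht) ?_
      simpa only [modular, Real.norm_of_nonneg (radialProfile_nonneg n G _)] using h
    obtain ⟨k, hk, -, hk1⟩ := exists_of_luxNorm_lt hfin
    refine ⟨Real.toNNReal (radialConst n * k), fun u hu => ?_⟩
    obtain ⟨hu, f, hf⟩ := hu
    set L := luxNorm G (volume.restrict (unitBall n)) (weakGradient (unitBall n) u) with hL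
    have hLtop : L < ⊤ := luxNorm_weakGradient_lt_top hG hu.1
    have key : ∀ l, L.toReal < l →
        luxNorm A (henonMeasure n α) u ≤ ENNReal.ofReal (radialConst n * k * l) := by
      intro l hl
      have hl0 : 0 < l := ENNReal.toReal_nonneg.trans_lt hl
      have hae := ae_henonMeasure_of_ae (α := α) hn hf
        (P := fun r y => |y| ≤ radialConst n * (l * radialProfile n G r))
        (ae_abs_le_radialProfile hn hG hu hf
          ((ENNReal.lt_ofReal_iff_toReal_lt hLtop.ne).2 hl))
      refine luxNorm_le (by positivity) (le_trans (lintegral_mono_ae ?_) hk1)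
      filter_upwards [hae] with x hx
      refine ENNReal.ofReal_le_ofReal (hA.monotoneOn (mem_Ici.2 (by positivity))
        (mem_Ici.2 (by positivity)) ?_)
      rw [div_le_div_iff₀ (by positivity) hk, Real.norm_eq_abs, Real.norm_eq_abs,
        abs_of_nonneg (radialProfile_nonneg n G _)]
      nlinarith [mul_le_mul_of_nonneg_right hx hk.le]
    have hcont : Tendsto (fun l => ENNReal.ofReal (radialConst n * k * l)) (𝓝[>] L.toReal)
        (𝓝 (ENNReal.ofReal (radialConst n * k * L.toReal))) :=
      ((ENNReal.continuous_ofReal.comp (by fun_prop)).tendsto _).mono_left nhdsWithin_le_nhds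
    refine (ge_of_tendsto hcont (eventually_nhdsWithin_of_forall key)).trans ?_
    rw [ENNReal.ofReal_mul (by positivity), ENNReal.ofReal_toReal hLtop.ne]
    exact mul_le_mul_right le_add_self _

end Continuity

/-! ### Compactness of the inclusion -/

section Compactness

variable {n : ℕ} {α : ℝ} {G : ℝ → ℝ}

/-- The oscillation bound tends to zero on short intervals away from the origin, at a rate that
depends only on the bound `l` for the gradients: `T` is taken large, then the interval short. -/
lemma exists_modulus_of_oscillation_le (hn : 1 ≤ n) (hG : IsNFunction G) {l ε r₀ : ℝ} (hl : 0 < l)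
    (hε : 0 < ε) (hr₀ : 0 < r₀) :
    ∃ δ > 0, ∃ T > 0, ∀ r s, r₀ ≤ r → s ≤ 1 → s - r < δ → ∀ y : ℝ,
      sphereMeasure n univ * ‖y‖ₑ ≤
        ENNReal.ofReal (l / T) * (1 + sphereMeasure n univ * annulusModular n G T r s) →
      |y| ≤ ε := by
  set σ := (sphereMeasure n).real univ with hσ
  have hσ0 : 0 < σ := sphereMeasure_real_pos hn
  have hσE : sphereMeasure n univ = ENNReal.ofReal σ := (ofReal_measureReal).symm
  set T := 2 * l / (σ * ε) with hT
  have hT0 : 0 < T := by positivity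
  set c := max (complementary G (T * r₀ ^ (1 - (n : ℝ)))) 1 with hc
  have hc0 : 0 < c := lt_max_of_lt_right one_pos
  refine ⟨(σ * c)⁻¹, by positivity, T, hT0, fun r s hr hs hrs y hy => ?_⟩
  have h1 : sphereMeasure n univ * annulusModular n G T r s ≤ 1 := by
    calc _ ≤ ENNReal.ofReal σ * (ENNReal.ofReal c * ENNReal.ofReal (σ * c)⁻¹) := by
          rw [hσE]
          gcongr
          refine (annulusModular_le hn hG hT0.le hr₀ hr hs).trans ?_
          gcongr
          exact le_max_left _ _
      _ = 1 := by
          rw [← ENNReal.ofReal_mul hc0.le, ← ENNReal.ofReal_mul hσ0.le, ← mul_assoc,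
            mul_inv_cancel₀ (by positivity), ENNReal.ofReal_one]
  have h2 : ENNReal.ofReal (σ * |y|) ≤ ENNReal.ofReal (l / T * 2) := by
    rw [ENNReal.ofReal_mul hσ0.le, ← hσE, ENNReal.ofReal_mul (by positivity), ← Real.norm_eq_abs,
      ofReal_norm, ENNReal.ofReal_ofNat]
    refine hy.trans ?_
    gcongr
    exact (add_le_add_right h1 1).trans_eq one_add_one_eq_two
  have h3 := (ENNReal.ofReal_le_ofReal_iff (by positivity)).1 h2
  have h4 : l / T * 2 = σ * ε := by rw [hT]; field_simp
  exact le_of_mul_le_mul_left (h4 ▸ h3) hσ0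

/-- A pointwise bounded sequence of functions, equicontinuous on `S`, has a subsequence that
converges pointwise on `S`. -/
lemma exists_subseq_cauchySeq {S : Set ℝ} {f : ℕ → ℝ → ℝ} {b : ℝ → ℝ}
    (hb : ∀ r ∈ S, ∀ k, |f k r| ≤ b r)
    (he : ∀ r ∈ S, ∀ ε > 0, ∃ δ > 0, ∀ s ∈ S, |s - r| < δ → ∀ k, |f k s - f k r| ≤ ε) :
    ∃ φ : ℕ → ℕ, StrictMono φ ∧ ∀ r ∈ S, CauchySeq fun k => f (φ k) r := by
  obtain ⟨D, hDS, hDc, hDd⟩ :=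
    (TopologicalSpace.IsSeparable.of_separableSpace S).exists_countable_dense_subset
  have := hDc.to_subtype
  have hcpt : IsCompact (Set.pi univ fun d : D => Icc (-b d) (b d)) :=
    isCompact_univ_pi fun _ => isCompact_Icc
  obtain ⟨a, -, φ, hφ, hlim⟩ := hcpt.tendsto_subseq (x := fun k (d : D) => f k d)
    fun k d _ => abs_le.1 (hb d (hDS d.2) k)
  refine ⟨φ, hφ, fun r hr => Metric.cauchySeq_iff.2 fun ε hε => ?_⟩
  obtain ⟨δ, hδ, hδr⟩ := he r hr (ε / 4) (by positivity)
  obtain ⟨d, hd, hrd⟩ := Metric.mem_closure_iff.1 (hDd hr) δ hδ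
  have hcd : CauchySeq fun k => f (φ k) d := (tendsto_pi_nhds.1 hlim ⟨d, hd⟩).cauchySeq
  obtain ⟨N, hN⟩ := Metric.cauchySeq_iff.1 hcd (ε / 4) (by positivity)
  refine ⟨N, fun i hi j hj => ?_⟩
  have hdr : |d - r| < δ := by rwa [abs_sub_comm]
  have h1 := abs_le.1 (hδr d (hDS hd) hdr (φ i))
  have h2 := abs_le.1 (hδr d (hDS hd) hdr (φ j))
  have h3 := abs_lt.1 (hN i hi j hj)
  exact abs_lt.2 ⟨by linarith, by linarith⟩

/-- A bounded sequence of radial functions has a subsequence converging almost everywhere, with a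
common multiple of the radial profile as a majorant. -/
lemma exists_subseq_tendsto_ae (hn : 1 ≤ n) (hG : IsNFunction G)
    {u : ℕ → EuclideanSpace ℝ (Fin n) → ℝ} (hu : ∀ k, u k ∈ Xrad n G) {M : ℝ≥0}
    (hM : ∀ k, sobolevNorm G (unitBall n) (u k) ≤ M) :
    ∃ (φ : ℕ → ℕ) (v : EuclideanSpace ℝ (Fin n) → ℝ) (c : ℝ), StrictMono φ ∧ 0 < c ∧
      (∀ᵐ x ∂henonMeasure n α, ∀ k, |u k x| ≤ c * radialProfile n G ‖x‖) ∧
      ∀ᵐ x ∂henonMeasure n α, Tendsto (fun k => u (φ k) x) atTop (𝓝 (v x)) := by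
  set l : ℝ := M + 1 with hl
  have hl0 : 0 < l := by positivity
  have hlt : ∀ k, luxNorm G (volume.restrict (unitBall n)) (weakGradient (unitBall n) (u k)) <
      ENNReal.ofReal l := fun k => by
    refine (le_add_self.trans (hM k)).trans_lt ?_
    rw [ENNReal.lt_ofReal_iff_toReal_lt ENNReal.coe_ne_top]
    simp [hl]
  choose hu0 f hf using hu
  choose P hP hosc using fun k => exists_ae_oscillation_le hn hG (hu0 k) (hf k)
  have hbd := fun k => ae_abs_le_radialProfile hn hG (hu0 k) (hf k) (hlt k)
  set S : Set ℝ := {r | r ∈ Ioo (0 : ℝ) 1 ∧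
    ∀ k, P k r ∧ |f k r| ≤ radialConst n * (l * radialProfile n G r)} with hS
  have hSae : ∀ᵐ r ∂volume.restrict (Ioo (0 : ℝ) 1), r ∈ S :=
    (ae_restrict_mem measurableSet_Ioo).and (ae_all_iff.2 fun k => (hP k).and (hbd k))
  obtain ⟨φ, hφ, hcauchy⟩ := exists_subseq_cauchySeq (S := S) (f := f)
    (b := fun r => radialConst n * (l * radialProfile n G r)) (fun r hr k => (hr.2 k).2) (by
      intro r hr ε hε
      have hr0 : 0 < r := hr.1.1
      obtain ⟨δ, hδ, T, hT, h⟩ := exists_modulus_of_oscillation_le hn hG hl0 hε (half_pos hr0)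
      refine ⟨min δ (r / 2), by positivity, fun s hs hsr k => ?_⟩
      have hsr1 := abs_lt.1 (hsr.trans_le (min_le_left _ _))
      have hsr2 := abs_lt.1 (hsr.trans_le (min_le_right _ _))
      rcases le_total s r with hle | hle
      · exact h s r (by linarith) hr.1.2.le (by linarith) _
          (hosc k l T s r (hlt k) hT (hs.2 k).1 (hr.2 k).1 hs.1.1 hle hr.1.2.le)
      · rw [abs_sub_comm]
        exact h r s (by linarith) hs.1.2.le (by linarith) _
          (hosc k l T r s (hlt k) hT (hr.2 k).1 (hs.2 k).1 hr0 hle hs.1.2.le))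
  refine ⟨φ, fun x => limUnder atTop fun k => f (φ k) ‖x‖, radialConst n * l, hφ,
    mul_pos (radialConst_pos n) hl0, ?_, ?_⟩ <;>
  refine henonMeasure_absolutelyContinuous.ae_le ?_ <;>
  filter_upwards [ae_all_iff.2 hf, ae_unitBall_of_ae hn hSae] with x hx hxS
  · intro k
    rw [hx k, mul_assoc]
    exact (hxS.2 k).2
  · simp only [hx]
    exact tendsto_nhds_limUnder (cauchySeq_tendsto_of_complete (hcauchy _ hxS))

lemma compactInclusion_of_lintegral_lt_top (hn : 1 ≤ n) (hα : 0 < α) (hG : IsNFunction G)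
    {H : ℝ → ℝ} (hH : IsNFunction H)
    (h : ∀ k : ℝ, 0 < k →
      ∫⁻ x, ENNReal.ofReal (H (k * radialProfile n G ‖x‖)) ∂henonMeasure n α < ⊤) :
    CompactInclusion n G H (henonMeasure n α) := by
  refine ⟨continuousInclusion_of_lintegral_lt_top hn hα hG hH (by simpa using h 1 one_pos), ?_⟩
  rintro u hu ⟨M, hM⟩
  obtain ⟨φ, v, c, hφ, hc, hbd, hlim⟩ := exists_subseq_tendsto_ae (α := α) hn hG hu hM
  have hum : ∀ k, AEStronglyMeasurable (u k) (henonMeasure n α) := fun k =>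
    (hu k).1.1.1.1.mono_ac henonMeasure_absolutelyContinuous
  have hvm : AEStronglyMeasurable v (henonMeasure n α) :=
    aestronglyMeasurable_of_tendsto_ae atTop (fun k => hum (φ k)) hlim
  have hvbd : ∀ᵐ x ∂henonMeasure n α, |v x| ≤ c * radialProfile n G ‖x‖ := by
    filter_upwards [hbd, hlim] with x hx hxlim
    exact le_of_tendsto hxlim.abs (Eventually.of_forall fun k => hx (φ k))
  refine ⟨v, ⟨hvm, (lintegral_mono_ae ?_).trans_lt (h c hc)⟩, φ, hφ, ?_⟩
  · filter_upwards [hvbd] with x hx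
    exact ENNReal.ofReal_le_ofReal (hH.monotoneOn (mem_Ici.2 (norm_nonneg _))
      (mem_Ici.2 ((abs_nonneg _).trans hx)) hx)
  refine ENNReal.tendsto_nhds_zero.2 fun ε hε => ?_
  set e : ℝ := (min ε 1).toReal with he
  have hmin : min ε 1 ≠ ⊤ := ne_top_of_le_ne_top ENNReal.one_ne_top (min_le_right _ _)
  have he0 : 0 < e := ENNReal.toReal_pos (lt_min hε one_pos).ne' hmin
  have heε : ENNReal.ofReal e ≤ ε := by
    rw [he, ENNReal.ofReal_toReal hmin]
    exact min_le_left _ _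
  have hdct := tendsto_lintegral_of_dominated_convergence' (μ := henonMeasure n α)
    (F := fun k x => ENNReal.ofReal (H (‖u (φ k) x - v x‖ / e))) (f := fun _ => 0)
    (fun x => ENNReal.ofReal (H (2 * c / e * radialProfile n G ‖x‖)))
    (fun k => (hH.aemeasurable_comp
      (((hum (φ k)).sub hvm).norm.aemeasurable.div_const e) fun x => by positivity).ennreal_ofReal)
    (fun k => by
      filter_upwards [hbd, hvbd] with x hx hvx
      have hp := radialProfile_nonneg n G ‖x‖
      refine ENNReal.ofReal_le_ofReal (hH.monotoneOn (mem_Ici.2 (by positivity))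
        (mem_Ici.2 (by positivity)) ?_)
      rw [div_mul_eq_mul_div]
      gcongr
      have := norm_sub_le (u (φ k) x) (v x)
      have := hx (φ k)
      simp only [Real.norm_eq_abs] at *
      linarith)
    (h _ (by positivity)).ne
    (by
      filter_upwards [hlim] with x hx
      have h0 : Tendsto (fun k => ‖u (φ k) x - v x‖ / e) atTop (𝓝 0) := by
        simpa using (tendsto_iff_norm_sub_tendsto_zero.1 hx).div_const e
      simpa using ENNReal.tendsto_ofReal (hH.tendsto_zero (fun k => by positivity) h0))
  rw [lintegral_zero] at hdct
  filter_upwards [hdct.eventually_le_const one_pos] with k hk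
  exact (luxNorm_le he0 hk).trans heε

end Compactness

theorem proposition4p2 (n : ℕ) (hn : 1 ≤ n) (α : ℝ) (hα : 0 < α) (G R : ℝ → ℝ)
    (hG : IsNFunction G) (hR : IsNFunction R) (hGR : IntegrabilityCondition n α G R) :
    ContinuousInclusion n G R (henonMeasure n α) ∧
      ∀ H : ℝ → ℝ, IsNFunction H → EssentiallySlower H R →
        CompactInclusion n G H (henonMeasure n α) := by
  have h := lintegral_radialProfile_lt_top hn hR hGR
  exact ⟨continuousInclusion_of_lintegral_lt_top hn hα hG hR h, fun H hH hHR =>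
    compactInclusion_of_lintegral_lt_top hn hα hG hH fun k hk =>
      lintegral_mul_radialProfile_lt_top hα hH hR hHR h hk⟩
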